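/- Let $\mathcal K^n$ be the family of nonempty convex compact subsets of $\mathbb R^n$ with the Hausdorff distance. For a linear subspace $H$ of $\mathbb R^n$ let $R_H$ be the orthogonal reflection in $H$, and call $K$ $H$-symmetric if $R_HK=K$. A symmetrization $\diamondsuit$ assigns to each subspace $H$ in a given collection $\mathcal G$ of linear subspaces of $\mathbb R^n$ (for example all subspaces, or all subspaces of dimension $1,\dots,n-1$) a map $\diamondsuit_H$ from $\mathcal K^n$ to the $H$-symmetric members of $\mathcal K^n$. Let $\mathcal F$ be the family of symmetrizations $\diamondsuit$ such that for all $H\in\mathcal G$ and $K,L\in\mathcal K^n$: (i) $K\subseteq L$ implies $\diamondsuit_HK\subseteq\diamondsuit_HL$; (ii) $\diamondsuit_H(K+x)=K$ whenever $R_HK=K$ and $x\in H^\perp$; (iii) $\diamondsuit_HK=K$ whenever $R_HK=K$. A sequence $(H_m)$ of subspaces is called shape-stable in $\mathcal K^n$ for $\diamondsuit$ with isometries $(\mathbb A_m)$ of $\mathbb R^n$ (for example rotations) if for every index $k$ and every $K\in\mathcal K^n$ the sequence $\mathbb A_m\diamondsuit_{H_m}\cdots\diamondsuit_{H_k}K$,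 $m\ge k$, converges in $\mathcal K^n$; here $(\mathbb A_m)$ does not depend on $K$ and $k$. Let $\diamondsuit\in\mathcal F$, let $(H_m)$ be a sequence in $\mathcal G$, and let $(\mathbb A_m)$ be a sequence of isometries of $\mathbb R^n$. (1) If $(H_m)$ is shape-stable in $\mathcal K^n$ for $\diamondsuit$ with isometries $(\mathbb A_m)$, then for every $\spadesuit\in\mathcal F$ it is shape-stable in $\mathcal K^n$ for $\spadesuit$ with the same isometries $(\mathbb A_m)$. (2) In particular, $(H_m)$ is shape-stable in $\mathcal K^n$ for $\diamondsuit$ with isometries $(\mathbb A_m)$ if and only if it is so for the fiber symmetrization $F_HK=\bigcup_{x\in H}\tfrac12\big(K\cap(H^\perp+x)+R_H(K\cap(H^\perp+x))\big)$, and if and only if it is so for the Minkowski symmetrization $M_HK=\tfrac12(K+R_HK)$. (3) If all $H_m$ are hyperplanes, then $(H_m)$ is shape-stable in $\mathcal K^n$ for $\diamondsuit$ with isometries $(\mathbb A_m)$ if and only if it is so for Steiner symmetrization, which replaces each nonempty section $K\cap(H^\perp+x)$, $x\in H$, by the closed segment in the line $H^\perp+x$ of the same length with midpoint $x$ (a segment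 of length $0$ being the point $x$). -/

import Mathlib

open Set Filter Topology MeasureTheory
open scoped Pointwise

noncomputable section

/-- The family `𝒦ⁿ` of nonempty convex compact subsets of `ℝⁿ`. -/
def convexCompacts (n : ℕ) : Set (Set (EuclideanSpace ℝ (Fin n))) :=
  {K | Convex ℝ K ∧ IsCompact K ∧ K.Nonempty}

/-- `K` is symmetric with respect to the linear subspace `H`, that is `R_H K = K`. -/
def IsSymmetricWrt {n : ℕ} (H : Submodule ℝ (EuclideanSpace ℝ (Fin n)))
    (K : Set (EuclideanSpace ℝ (Fin n))) : Prop :=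
  H.reflection '' K = K

/-- A symmetrization assigns to each linear subspace `H` of `ℝⁿ` a transformation of sets.
It is only ever used on members of `𝒦ⁿ`; its values on other sets are irrelevant. -/
abbrev SetTransform (n : ℕ) : Type :=
  Submodule ℝ (EuclideanSpace ℝ (Fin n)) →
    Set (EuclideanSpace ℝ (Fin n)) → Set (EuclideanSpace ℝ (Fin n))

/-- The restriction of `S` to `𝒦ⁿ` is an `H`-symmetrization `𝒦ⁿ → (𝒦ⁿ)_H`: it sends nonempty
convex compact sets to `H`-symmetric nonempty convex compact sets. -/
def IsSymmetrizationAt {n : ℕ} (S : Set (EuclideanSpace ℝ (Fin n)) → Set (EuclideanSpace ℝ (Fin n)))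
    (H : Submodule ℝ (EuclideanSpace ℝ (Fin n))) : Prop :=
  ∀ K ∈ convexCompacts n, S K ∈ convexCompacts n ∧ IsSymmetricWrt H (S K)

/-- The family `ℱ` of symmetrizations on `𝒦ⁿ` which are monotone, invariant on `H`-symmetric sets,
and invariant under `Hᗮ`-translations of `H`-symmetric sets. Here `𝒢` is the collection of
subspaces `H` under consideration (for instance all subspaces, or all subspaces of dimension
`1, …, n - 1`). -/
structure InFamilyF {n : ℕ} (𝒢 : Set (Submodule ℝ (EuclideanSpace ℝ (Fin n))))
    (S : SetTransform n) : Prop where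
  isSymmetrization : ∀ H ∈ 𝒢, IsSymmetrizationAt (S H) H
  monotone : ∀ H ∈ 𝒢, ∀ K ∈ convexCompacts n, ∀ L ∈ convexCompacts n, K ⊆ L → S H K ⊆ S H L
  translation_invariant : ∀ H ∈ 𝒢, ∀ K ∈ convexCompacts n, IsSymmetricWrt H K →
    ∀ x ∈ Hᗮ, S H (x +ᵥ K) = K
  invariant : ∀ H ∈ 𝒢, ∀ K ∈ convexCompacts n, IsSymmetricWrt H K → S H K = K

/-- The section `K ∩ (Hᗮ + x)`. -/
def orthSection {n : ℕ} (H : Submodule ℝ (EuclideanSpace ℝ (Fin n)))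
    (K : Set (EuclideanSpace ℝ (Fin n))) (x : EuclideanSpace ℝ (Fin n)) :
    Set (EuclideanSpace ℝ (Fin n)) :=
  {y ∈ K | y - x ∈ Hᗮ}

/-- Minkowski symmetrization `M_H K = (K + R_H K) / 2`. -/
def minkowskiSymm (n : ℕ) : SetTransform n := fun H K =>
  (1 / 2 : ℝ) • (K + H.reflection '' K)

/-- Fiber symmetrization: for every `x ∈ H` the section `C = K ∩ (Hᗮ + x)` is replaced by its
central Minkowski symmetral about `x` inside `Hᗮ + x`. On `Hᗮ + x` the point reflection about `x`
is the restriction of `R_H`, so this symmetral is `(C + R_H C) / 2`. -/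
def fiberSymm (n : ℕ) : SetTransform n := fun H K =>
  ⋃ x ∈ H, minkowskiSymm n H (orthSection H K x)

/-- Steiner symmetrization (meaningful when `H` is a hyperplane): for every `x ∈ H` such that the
section `K ∩ (Hᗮ + x)` is nonempty, this section is replaced by the closed segment in the line
`Hᗮ + x` with the same length and with midpoint `x`; length is the one-dimensional Hausdorff
measure. -/
def steinerSymm (n : ℕ) : SetTransform n := fun H K =>
  {y | ∃ x ∈ H, (orthSection H K x).Nonempty ∧ y - x ∈ Hᗮ ∧
    ‖y - x‖ ≤ (Measure.hausdorffMeasure 1 (orthSection H K x)).toReal / 2}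

/-- `H` is a linear hyperplane of `ℝⁿ`. -/
def IsHyperplane {n : ℕ} (H : Submodule ℝ (EuclideanSpace ℝ (Fin n))) : Prop :=
  Module.finrank ℝ H + 1 = n

/-- The symmetrization process started at index `k`:
`symmIterate S H k K j = S_{H (k + j)} ⋯ S_{H (k + 1)} S_{H k} K`. -/
def symmIterate {n : ℕ} (S : SetTransform n) (H : ℕ → Submodule ℝ (EuclideanSpace ℝ (Fin n)))
    (k : ℕ) (K : Set (EuclideanSpace ℝ (Fin n))) : ℕ → Set (EuclideanSpace ℝ (Fin n))
  | 0 => S (H k) K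
  | j + 1 => S (H (k + (j + 1))) (symmIterate S H k K j)

/-- The sequence of subspaces `H` is shape-stable in `𝒦ⁿ` for `S` with the isometries `A`: for
every starting index `k` and every `K ∈ 𝒦ⁿ`, the sequence `A_m S_{H m} ⋯ S_{H k} K`, `m ≥ k`
(written with `m = k + j`), converges in the Hausdorff distance to an element of `𝒦ⁿ`. -/
def ShapeStableWith {n : ℕ} (S : SetTransform n)
    (H : ℕ → Submodule ℝ (EuclideanSpace ℝ (Fin n)))
    (A : ℕ → EuclideanSpace ℝ (Fin n) ≃ᵢ EuclideanSpace ℝ (Fin n)) : Prop :=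
  ∀ k : ℕ, ∀ K ∈ convexCompacts n, ∃ L ∈ convexCompacts n,
    Tendsto (fun j : ℕ => Metric.hausdorffEDist (A (k + j) '' symmIterate S H k K j) L)
      atTop (𝓝 0)

end

/-! Every member of `ℱ` is squeezed between the two extreme ones: `F_H K ⊆ S_H K ⊆ M_H K`
(`InFamilyF.fiberSymm_subset`, `InFamilyF.subset_minkowskiSymm`). The lower bound makes `S`
volume-nondecreasing, since fiber symmetrization is, by Brunn-Minkowski in each fiber. On the upper
side, `M` preserves mean width and commutes with `ε`-thickening up to inclusion. It therefore
suffices to pass from `S` to `M` and from `M` to any `T` in `ℱ`. In both directions the iterates are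
bounded, so Blaschke selection reduces convergence to showing `C ⊆ C'` for any two cluster points.

From `S` to `M`: take a Minkowski iterate close to `C`, thicken it by `ε`, and continue with `S`.
The result stays inside the thickened later Minkowski iterates, so its limit `L` lies in the
`ε`-thickenings of both `C` and `C'`. As `S` loses no volume, `L` has almost the volume of the
thickening of `C`. Hence the thickening of `C` is contained in that of `C'`; now let `ε` tend to
`0`.

From `M` to `T`: take a `T`-iterate close to `C'` and continue with `M`. The result contains all
later `T`-iterates, so its limit `L` contains `C` and `C'`. As `M` preserves mean width, that of `L`
is almost that of `C'`, which forces `C ⊆ C'`.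

Steiner symmetrization is fiber symmetrization when `H` is a hyperplane. -/

open scoped ENNReal

/-! ### Brunn-Minkowski and Prékopa-Leindler inequalities -/

/-- The one-dimensional Brunn-Minkowski inequality for compact sets. -/
theorem Real.volume_add_volume_le_of_isCompact {A B C : Set ℝ} (hA : IsCompact A) (hB : IsCompact B)
    (hA0 : A.Nonempty) (hB0 : B.Nonempty) (hC : ∀ a ∈ A, ∀ b ∈ B, a + b ∈ C) :
    volume A + volume B ≤ volume C := by
  obtain ⟨a, ha, hamax⟩ := hA.exists_isGreatest hA0
  obtain ⟨b, hb, hbmin⟩ := hB.exists_isLeast hB0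
  -- With `a` the maximum of `A` and `b` the minimum of `B`, the translates `A + b` and `a + B` meet
  -- only at `a + b`; removing `b` from `B` makes them disjoint at no cost in measure.
  have h1 : (fun x => x + b) '' A ∪ (fun x => a + x) '' (B \ {b}) ⊆ C := by
    rintro x (⟨y, hy, rfl⟩ | ⟨y, hy, rfl⟩)
    · exact hC y hy b hb
    · exact hC a ha y hy.1
  have hd : Disjoint ((fun x => x + b) '' A) ((fun x => a + x) '' (B \ {b})) := by
    rw [Set.disjoint_left]
    rintro x ⟨y, hy, rfl⟩ ⟨z, hz, hzx⟩
    have h2 := hamax hy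
    have h3 := hbmin hz.1
    have h4 : b < z := lt_of_le_of_ne h3 (fun h => hz.2 (by simp [h]))
    simp only at hzx
    linarith
  have hm : MeasurableSet ((fun x => a + x) '' (B \ {b})) :=
    (measurableEmbedding_addLeft a).measurableSet_image.2
      (hB.isClosed.measurableSet.diff (measurableSet_singleton b))
  calc volume A + volume B
      = volume ((fun x => x + b) '' A) + volume ((fun x => a + x) '' (B \ {b})) := by
        rw [Set.image_add_right, Set.image_add_left, measure_preimage_add_right,
          measure_preimage_add, measure_sdiff_null (by simp)]
    _ = volume ((fun x => x + b) '' A ∪ (fun x => a + x) '' (B \ {b})) :=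
        (measure_union hd hm).symm
    _ ≤ volume C := measure_mono h1

/-- The one-dimensional Brunn-Minkowski inequality for measurable sets. -/
theorem Real.volume_add_volume_le {A B C : Set ℝ} (hA : MeasurableSet A) (hB : MeasurableSet B)
    (hA0 : A.Nonempty) (hB0 : B.Nonempty) (hC : ∀ a ∈ A, ∀ b ∈ B, a + b ∈ C) :
    volume A + volume B ≤ volume C := by
  obtain ⟨a, ha⟩ := hA0
  obtain ⟨b, hb⟩ := hB0
  rw [hA.measure_eq_iSup_isCompact, hB.measure_eq_iSup_isCompact]
  simp only [iSup_and']
  have : Nonempty {s : Set ℝ // s ⊆ A ∧ IsCompact s} := ⟨⟨∅, by simp⟩⟩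
  have : Nonempty {s : Set ℝ // s ⊆ B ∧ IsCompact s} := ⟨⟨∅, by simp⟩⟩
  rw [iSup_subtype', iSup_subtype']
  refine ENNReal.iSup_add_iSup_le ?_
  rintro ⟨s, hs, hsc⟩ ⟨t, ht, htc⟩
  calc volume s + volume t ≤ volume (insert a s) + volume (insert b t) := by
        gcongr <;> exact Set.subset_insert _ _
    _ ≤ volume C := by
        refine Real.volume_add_volume_le_of_isCompact (hsc.insert a) (htc.insert b)
          (Set.insert_nonempty _ _) (Set.insert_nonempty _ _) ?_
        intro x hx y hy
        exact hC x (Set.insert_subset ha hs hx) y (Set.insert_subset hb ht hy)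

theorem Real.volume_add_volume_le_two_mul {A B C : Set ℝ} (hA : MeasurableSet A)
    (hB : MeasurableSet B) (hA0 : A.Nonempty) (hB0 : B.Nonempty)
    (hC : ∀ a ∈ A, ∀ b ∈ B, (1 / 2 : ℝ) * (a + b) ∈ C) :
    volume A + volume B ≤ 2 * volume C := by
  have h := Real.volume_add_volume_le (C := (fun x => (1 / 2 : ℝ) * x) ⁻¹' C) hA hB hA0 hB0 hC
  rwa [Real.volume_preimage_mul_left (by norm_num), show |((1 / 2 : ℝ))⁻¹| = 2 by norm_num,
    ENNReal.ofReal_ofNat] at h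

theorem lintegral_eq_lintegral_Ioi_meas_lt {α : Type*} [MeasurableSpace α] (μ : Measure α)
    {f : α → ℝ≥0∞} (hf : Measurable f) (hfin : ∀ x, f x ≠ ⊤) :
    ∫⁻ x, f x ∂μ = ∫⁻ t in Ioi (0 : ℝ), μ {x | ENNReal.ofReal t < f x} := by
  have h := lintegral_eq_lintegral_meas_lt μ (f := fun x => (f x).toReal)
    (Eventually.of_forall fun x => ENNReal.toReal_nonneg) hf.ennreal_toReal.aemeasurable
  simp only [ENNReal.ofReal_toReal (hfin _)] at h
  rw [h]
  refine setLIntegral_congr_fun measurableSet_Ioi fun t ht => ?_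
  congr 1
  ext x
  exact (ENNReal.ofReal_lt_iff_lt_toReal (le_of_lt ht) (hfin x)).symm

/-- The Prékopa-Leindler inequality on the line, for functions of supremum `1`. -/
theorem lintegral_add_lintegral_le_of_iSup_eq_one {f g h : ℝ → ℝ≥0∞} (hf : Measurable f)
    (hg : Measurable g) (hh : Measurable h) (hhfin : ∀ x, h x ≠ ⊤) (hf1 : ⨆ x, f x = 1)
    (hg1 : ⨆ x, g x = 1)
    (hfgh : ∀ x y, f x * g y ≤ h ((1 / 2 : ℝ) * (x + y)) ^ 2) :
    (∫⁻ x, f x) + (∫⁻ x, g x) ≤ 2 * ∫⁻ x, h x := by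
  have hfle : ∀ x, f x ≤ 1 := fun x => hf1 ▸ le_iSup f x
  have hgle : ∀ x, g x ≤ 1 := fun x => hg1 ▸ le_iSup g x
  rw [lintegral_eq_lintegral_Ioi_meas_lt _ hf
      (fun x => ne_top_of_le_ne_top ENNReal.one_ne_top (hfle x)),
    lintegral_eq_lintegral_Ioi_meas_lt _ hg
      (fun x => ne_top_of_le_ne_top ENNReal.one_ne_top (hgle x)),
    lintegral_eq_lintegral_Ioi_meas_lt _ hh hhfin]
  have hanti : ∀ q : ℝ → ℝ≥0∞, Measurable fun t : ℝ => volume {x | ENNReal.ofReal t < q x} := by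
    intro q
    refine Antitone.measurable fun s t hst => measure_mono fun x hx => ?_
    exact lt_of_le_of_lt (ENNReal.ofReal_le_ofReal hst) hx
  rw [← lintegral_add_left (hanti f), ← lintegral_const_mul _ (hanti h)]
  refine setLIntegral_mono (measurable_const.mul (hanti h)) fun t ht => ?_
  rcases lt_or_ge t 1 with ht1 | ht1
  -- Below level `1` both superlevel sets are nonempty, because both suprema equal `1`, so
  -- Brunn-Minkowski applies level by level. From level `1` on they are empty.
  · have ht1' : ENNReal.ofReal t < 1 := by simpa using (ENNReal.ofReal_lt_one.2 ht1)
    obtain ⟨x, hx⟩ := lt_iSup_iff.1 (hf1 ▸ ht1')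
    obtain ⟨y, hy⟩ := lt_iSup_iff.1 (hg1 ▸ ht1')
    refine Real.volume_add_volume_le_two_mul (measurableSet_lt measurable_const hf)
      (measurableSet_lt measurable_const hg) ⟨x, hx⟩ ⟨y, hy⟩ ?_
    intro a ha b hb
    by_contra hcon
    have h1 : h ((1 / 2 : ℝ) * (a + b)) ≤ ENNReal.ofReal t := not_lt.1 hcon
    have h2 : ENNReal.ofReal t * ENNReal.ofReal t < f a * g b := ENNReal.mul_lt_mul ha hb
    have h3 := hfgh a b
    rw [sq] at h3
    exact absurd (h2.trans_le (h3.trans (mul_le_mul' h1 h1))) (lt_irrefl _)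
  · have e1 : ∀ q : ℝ → ℝ≥0∞, (∀ x, q x ≤ 1) → {x | ENNReal.ofReal t < q x} = ∅ := by
      intro q hq
      ext x
      simp only [mem_ofPred_eq, mem_empty_iff_false, iff_false, not_lt]
      exact (hq x).trans (by simpa using ENNReal.ofReal_le_ofReal ht1)
    rw [e1 f hfle, e1 g hgle]
    simp

/-- The arithmetic-geometric mean inequality; it turns the additive estimate for normalized
functions into the multiplicative one. -/
theorem ENNReal.mul_le_sq_of_add_le_two_mul {a b c : ℝ≥0∞} (h : a + b ≤ 2 * c) :
    a * b ≤ c ^ 2 := by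
  rcases eq_or_ne c ⊤ with rfl | hc
  · simp
  have hab : a + b ≠ ⊤ := ne_top_of_le_ne_top (ENNReal.mul_ne_top (by simp) hc) h
  have ha : a ≠ ⊤ := fun h => hab (by simp [h])
  have hb : b ≠ ⊤ := fun h => hab (by simp [h])
  lift a to NNReal using ha
  lift b to NNReal using hb
  lift c to NNReal using hc
  norm_cast at h ⊢
  rw [← NNReal.coe_le_coe] at h ⊢
  push_cast at h ⊢
  nlinarith [sq_nonneg ((a : ℝ) - b), a.2, b.2, c.2, NNReal.coe_nonneg a, NNReal.coe_nonneg b, NNReal.coe_nonneg c]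

/-- The Prékopa-Leindler inequality on the line, for bounded functions. -/
theorem lintegral_mul_lintegral_le_of_bounded {f g h : ℝ → ℝ≥0∞} (hf : Measurable f)
    (hg : Measurable g) (hh : Measurable h) (hhfin : ∀ x, h x ≠ ⊤) {N : ℝ≥0∞} (hN : N ≠ ⊤)
    (hfN : ∀ x, f x ≤ N) (hgN : ∀ x, g x ≤ N)
    (hfgh : ∀ x y, f x * g y ≤ h ((1 / 2 : ℝ) * (x + y)) ^ 2) :
    (∫⁻ x, f x) * ∫⁻ x, g x ≤ (∫⁻ x, h x) ^ 2 := by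
  set a := ⨆ x, f x with ha
  set b := ⨆ x, g x with hb
  have ha' : a ≠ ⊤ := ne_top_of_le_ne_top hN (iSup_le hfN)
  have hb' : b ≠ ⊤ := ne_top_of_le_ne_top hN (iSup_le hgN)
  rcases eq_or_ne a 0 with ha0 | ha0
  · have : ∀ x, f x = 0 := fun x => le_antisymm (ha0 ▸ le_iSup f x) zero_le
    simp [this]
  rcases eq_or_ne b 0 with hb0 | hb0
  · have : ∀ x, g x = 0 := fun x => le_antisymm (hb0 ▸ le_iSup g x) zero_le
    simp [this]
  -- The geometric mean of the two suprema: dividing `f`, `g`, `h` by `a`, `b`, `c` preserves the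
  -- pointwise hypothesis because `c ^ 2 = a * b`.
  set c : ℝ≥0∞ := (a * b) ^ (1 / 2 : ℝ) with hc
  have hc2 : c ^ 2 = a * b := by
    rw [hc, ← ENNReal.rpow_natCast, ← ENNReal.rpow_mul]; norm_num
  have hab0 : a * b ≠ 0 := mul_ne_zero ha0 hb0
  have habt : a * b ≠ ⊤ := ENNReal.mul_ne_top ha' hb'
  have hc0 : c ≠ 0 := fun h => hab0 (by rw [← hc2, h]; simp)
  have hct : c ≠ ⊤ := fun h => habt (by rw [← hc2, h]; simp)
  have key := lintegral_add_lintegral_le_of_iSup_eq_one (f := fun x => a⁻¹ * f x)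
    (g := fun x => b⁻¹ * g x) (h := fun x => c⁻¹ * h x) (hf.const_mul _) (hg.const_mul _)
    (hh.const_mul _) (fun x => ENNReal.mul_ne_top (ENNReal.inv_ne_top.2 hc0) (hhfin x))
    (by rw [← ENNReal.mul_iSup, ← ha, ENNReal.inv_mul_cancel ha0 ha'])
    (by rw [← ENNReal.mul_iSup, ← hb, ENNReal.inv_mul_cancel hb0 hb'])
    (by
      intro x y
      rw [mul_pow, ← ENNReal.inv_pow, hc2, ENNReal.mul_inv (Or.inl ha0) (Or.inl ha')]
      calc a⁻¹ * f x * (b⁻¹ * g y) = a⁻¹ * b⁻¹ * (f x * g y) := by ring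
        _ ≤ _ := by gcongr; exact hfgh x y)
  have key2 := ENNReal.mul_le_sq_of_add_le_two_mul key
  rw [lintegral_const_mul _ hf, lintegral_const_mul _ hg, lintegral_const_mul _ hh, mul_pow,
    ← ENNReal.inv_pow, hc2] at key2
  have e : a⁻¹ * (∫⁻ x, f x) * (b⁻¹ * ∫⁻ x, g x) = (a * b)⁻¹ * ((∫⁻ x, f x) * ∫⁻ x, g x) := by
    rw [ENNReal.mul_inv (Or.inl ha0) (Or.inl ha')]; ring
  rw [e] at key2
  exact (ENNReal.mul_le_mul_iff_right (ENNReal.inv_ne_zero.2 habt)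
    (ENNReal.inv_ne_top.2 hab0)).1 key2

/-- The Prékopa-Leindler inequality on the line. -/
theorem lintegral_mul_lintegral_le_real {f g h : ℝ → ℝ≥0∞} (hf : Measurable f)
    (hg : Measurable g) (hh : Measurable h)
    (hfgh : ∀ x y, f x * g y ≤ h ((1 / 2 : ℝ) * (x + y)) ^ 2) :
    (∫⁻ x, f x) * ∫⁻ x, g x ≤ (∫⁻ x, h x) ^ 2 := by
  have hsup : ∀ q : ℝ → ℝ≥0∞, Measurable q →
      ∫⁻ x, q x = ⨆ N : ℕ, ∫⁻ x, min (q x) N := by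
    intro q hq
    rw [← lintegral_iSup (fun N => hq.min measurable_const)
      (fun i j hij x => min_le_min_left _ (by exact_mod_cast hij))]
    congr 1
    ext x
    have : ⨆ N : ℕ, min (q x) (N : ℝ≥0∞) = q x ⊓ ⨆ N : ℕ, (N : ℝ≥0∞) := (inf_iSup_eq _ _).symm
    rw [this, ENNReal.iSup_natCast]
    simp
  rw [hsup f hf, hsup g hg, ENNReal.iSup_mul]
  refine iSup_le fun N => ?_
  rw [ENNReal.mul_iSup]
  refine iSup_le fun M => ?_
  -- The pointwise hypothesis survives truncation only if `f`, `g` and `h` are cut at a common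
  -- level.
  set P : ℕ := max N M
  calc (∫⁻ x, min (f x) N) * ∫⁻ x, min (g x) M
      ≤ (∫⁻ x, min (f x) P) * ∫⁻ x, min (g x) P := by
        gcongr
        · exact le_max_left _ _
        · exact le_max_right _ _
    _ ≤ (∫⁻ x, min (h x) P) ^ 2 := by
        refine lintegral_mul_lintegral_le_of_bounded (hf.min measurable_const)
          (hg.min measurable_const) (hh.min measurable_const)
          (fun x => ne_top_of_le_ne_top (ENNReal.natCast_ne_top P) (min_le_right _ _))
          (ENNReal.natCast_ne_top P) (fun x => min_le_right _ _) (fun x => min_le_right _ _) ?_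
        intro x y
        rcases le_total (h ((1 / 2 : ℝ) * (x + y))) P with hle | hle
        · rw [min_eq_left hle]
          exact (mul_le_mul' (min_le_left _ _) (min_le_left _ _)).trans (hfgh x y)
        · rw [min_eq_right hle, sq]
          exact mul_le_mul' (min_le_right _ _) (min_le_right _ _)
    _ ≤ (∫⁻ x, h x) ^ 2 := by
        gcongr
        exact min_le_left _ _

/-- The **Prékopa-Leindler inequality** in `ℝᵈ` for the midpoint. -/
theorem lintegral_mul_lintegral_le_pi (d : ℕ) {f g h : (Fin d → ℝ) → ℝ≥0∞} (hf : Measurable f)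
    (hg : Measurable g) (hh : Measurable h)
    (hfgh : ∀ x y, f x * g y ≤ h ((1 / 2 : ℝ) • (x + y)) ^ 2) :
    (∫⁻ x, f x) * ∫⁻ x, g x ≤ (∫⁻ x, h x) ^ 2 := by
  induction d with
  | zero =>
    have e : ∀ q : (Fin 0 → ℝ) → ℝ≥0∞, ∫⁻ x, q x = q 0 := by
      intro q
      rw [lintegral_unique, volume_pi]
      simp only [Measure.pi_empty_univ, mul_one]
      exact congrArg q (Subsingleton.elim _ _)
    rw [e, e, e]
    simpa using hfgh 0 0
  | succ d ih =>
    let e := (MeasurableEquiv.piFinSuccAbove (fun _ : Fin (d + 1) => ℝ) 0).symm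
    have he : MeasurePreserving e := (volume_preserving_piFinSuccAbove (fun _ => ℝ) 0).symm
    have hint : ∀ q : (Fin (d + 1) → ℝ) → ℝ≥0∞, Measurable q →
        ∫⁻ x, q x = ∫⁻ t : ℝ, ∫⁻ z : Fin d → ℝ, q (e (t, z)) := by
      intro q hq
      rw [← he.lintegral_comp hq, Measure.volume_eq_prod,
        lintegral_prod (fun z => q (e z)) (hq.comp e.measurable).aemeasurable]
    have hmeas : ∀ q : (Fin (d + 1) → ℝ) → ℝ≥0∞, Measurable q →
        Measurable fun t : ℝ => ∫⁻ z : Fin d → ℝ, q (e (t, z)) := fun q hq =>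
      (hq.comp e.measurable).lintegral_prod_right'
    rw [hint f hf, hint g hg, hint h hh]
    -- One-dimensional case in the first coordinate, applied to the integrals over the others; its
    -- pointwise hypothesis is the induction hypothesis on slices.
    refine lintegral_mul_lintegral_le_real (hmeas f hf) (hmeas g hg) (hmeas h hh) ?_
    intro s t
    refine ih (hf.comp (e.measurable.comp measurable_prodMk_left))
      (hg.comp (e.measurable.comp measurable_prodMk_left))
      (hh.comp (e.measurable.comp measurable_prodMk_left)) ?_
    intro x y
    refine (hfgh (e (s, x)) (e (t, y))).trans (le_of_eq ?_)
    congr 2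
    ext i
    refine Fin.cases ?_ (fun j => ?_) i
    · simp [e, MeasurableEquiv.piFinSuccAbove]
    · simp [e, MeasurableEquiv.piFinSuccAbove, mul_add]

/-- The volume of a compact set is at most the volume of its central Minkowski symmetral. -/
theorem volume_le_volume_of_half_sub_mem {W : Type*} [NormedAddCommGroup W] [InnerProductSpace ℝ W]
    [FiniteDimensional ℝ W] [MeasurableSpace W] [BorelSpace W] {C D : Set W}
    (hC : MeasurableSet C) (hD : MeasurableSet D)
    (hCD : ∀ a ∈ C, ∀ b ∈ C, (1 / 2 : ℝ) • (a - b) ∈ D) : volume C ≤ volume D := by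
  classical
  set d := Module.finrank ℝ W
  let e : (Fin d → ℝ) ≃ᵐ W := (MeasurableEquiv.toLp 2 (Fin d → ℝ)).trans
    (stdOrthonormalBasis ℝ W).measurableEquiv.symm
  have he : MeasurePreserving e :=
    (stdOrthonormalBasis ℝ W).measurePreserving_measurableEquiv.symm.comp
      (PiLp.volume_preserving_toLp (Fin d))
  have hlin : ∀ x y : Fin d → ℝ, e ((1 / 2 : ℝ) • (x + y)) = (1 / 2 : ℝ) • (e x + e y) := by
    intro x y
    change (stdOrthonormalBasis ℝ W).repr.symm (WithLp.toLp 2 _) = (1 / 2 : ℝ) •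
      ((stdOrthonormalBasis ℝ W).repr.symm (WithLp.toLp 2 x) +
        (stdOrthonormalBasis ℝ W).repr.symm (WithLp.toLp 2 y))
    rw [← map_add, ← map_smul]
    rfl
  have hvol : ∀ s : Set W, MeasurableSet s → ∫⁻ x, (e ⁻¹' s).indicator 1 x = volume s := by
    intro s hs
    rw [lintegral_indicator_one (e.measurable hs), he.measure_preimage hs.nullMeasurableSet]
  have hneg : volume (-C) = volume C := Measure.measure_neg volume C
  -- Prékopa-Leindler for the indicators of `C`, `-C` and `D`. Since `-C` has the volume of `C`, it
  -- compares the squares of the two volumes.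
  have h := lintegral_mul_lintegral_le_pi d (f := (e ⁻¹' C).indicator 1)
    (g := (e ⁻¹' (-C)).indicator 1) (h := (e ⁻¹' D).indicator 1)
    (measurable_one.indicator (e.measurable hC)) (measurable_one.indicator (e.measurable hC.neg))
    (measurable_one.indicator (e.measurable hD)) (by
      intro x y
      by_cases hx : e x ∈ C
      · by_cases hy : -e y ∈ C
        · have : (1 / 2 : ℝ) • (x + y) ∈ e ⁻¹' D := by
            have := hCD _ hx _ hy
            rwa [sub_neg_eq_add, ← hlin] at this
          rw [Set.indicator_of_mem this]
          simp [Set.indicator]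
          split_ifs
          all_goals simp
        · have : y ∉ e ⁻¹' (-C) := hy
          simp [Set.indicator_of_notMem this]
      · have : x ∉ e ⁻¹' C := hx
        simp [Set.indicator_of_notMem this])
  rw [hvol C hC, hvol _ hC.neg, hvol D hD, hneg, ← sq] at h
  exact (ENNReal.pow_le_pow_left_iff (by norm_num)).1 h

/-! ### Support functions and mean width -/

section SupportFunction

variable {E : Type*} [NormedAddCommGroup E] [InnerProductSpace ℝ E]

/-- The support function of a set. -/
noncomputable def supportFn (K : Set E) (u : E) : ℝ := sSup ((fun x => inner ℝ x u) '' K)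

theorem inner_le_supportFn {K : Set E} (hK : IsCompact K) (u : E) {x : E} (hx : x ∈ K) :
    inner ℝ x u ≤ supportFn K u :=
  le_csSup (hK.image (by fun_prop)).bddAbove (mem_image_of_mem _ hx)

theorem exists_inner_eq_supportFn {K : Set E} (hK : IsCompact K) (hne : K.Nonempty) (u : E) :
    ∃ x ∈ K, inner ℝ x u = supportFn K u :=
  (hK.image (f := fun x => inner ℝ x u) (by fun_prop)).sSup_mem (hne.image _)

theorem supportFn_le {K : Set E} (hne : K.Nonempty) {u : E} {c : ℝ}
    (h : ∀ x ∈ K, inner ℝ x u ≤ c) : supportFn K u ≤ c :=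
  csSup_le (hne.image _) (by rintro _ ⟨x, hx, rfl⟩; exact h x hx)

theorem continuous_supportFn {K : Set E} (hK : IsCompact K) : Continuous (supportFn K) :=
  hK.continuous_sSup (f := fun u x => inner ℝ x u) (by fun_prop)

theorem supportFn_le_add_of_subset_cthickening {K L : Set E} (hKne : K.Nonempty) (hL : IsCompact L)
    {δ : ℝ} (hδ : 0 ≤ δ) (h : K ⊆ Metric.cthickening δ L) (u : E) :
    supportFn K u ≤ supportFn L u + δ * ‖u‖ := by
  refine supportFn_le hKne fun x hx => ?_
  have h1 := h hx
  rw [hL.cthickening_eq_biUnion_closedBall hδ] at h1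
  simp only [mem_iUnion, Metric.mem_closedBall, exists_prop] at h1
  obtain ⟨y, hy, hxy⟩ := h1
  have h2 : inner ℝ x u = inner ℝ y u + inner ℝ (x - y) u := by
    rw [← inner_add_left]; simp
  have h3 : inner ℝ (x - y) u ≤ ‖x - y‖ * ‖u‖ := real_inner_le_norm _ _
  rw [dist_eq_norm] at hxy
  have h4 := inner_le_supportFn hL u hy
  nlinarith [norm_nonneg u]

theorem supportFn_mono {K L : Set E} (hKne : K.Nonempty) (hL : IsCompact L) (h : K ⊆ L) (u : E) :
    supportFn K u ≤ supportFn L u :=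
  supportFn_le hKne fun _ hx => inner_le_supportFn hL u (h hx)

/-- Hahn-Banach separation, with the separating functional represented by a vector. -/
theorem mem_of_forall_inner_le_supportFn [CompleteSpace E] {K : Set E} (hc : Convex ℝ K)
    (hcl : IsClosed K) (hne : K.Nonempty) {x : E} (h : ∀ u, inner ℝ x u ≤ supportFn K u) :
    x ∈ K := by
  by_contra hx
  obtain ⟨f, c, hf1, hf2⟩ := geometric_hahn_banach_closed_point hc hcl hx
  obtain ⟨u, rfl⟩ := (InnerProductSpace.toDual ℝ E).surjective f
  simp only [InnerProductSpace.toDual_apply_apply] at hf1 hf2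
  have h1 : supportFn K u ≤ c := supportFn_le hne fun y hy => by
    rw [real_inner_comm]; exact (hf1 y hy).le
  have h2 := h u
  rw [real_inner_comm] at h2
  linarith

theorem supportFn_image_linearIsometryEquiv (R : E ≃ₗᵢ[ℝ] E) (K : Set E) (u : E) :
    supportFn (R '' K) u = supportFn K (R.symm u) := by
  unfold supportFn
  rw [image_image]
  congr 2
  ext x
  rw [← R.symm.inner_map_map]
  simp

theorem supportFn_image_add_const {K : Set E} (hK : IsCompact K) (hne : K.Nonempty) (t u : E) :
    supportFn ((fun x => x + t) '' K) u = supportFn K u + inner ℝ t u := by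
  apply le_antisymm
  · refine supportFn_le (hne.image _) ?_
    rintro _ ⟨x, hx, rfl⟩
    rw [inner_add_left]
    gcongr
    exact inner_le_supportFn hK u hx
  · obtain ⟨x, hx, hxu⟩ := exists_inner_eq_supportFn hK hne u
    rw [← hxu, ← inner_add_left]
    exact inner_le_supportFn (hK.image (by fun_prop)) u (mem_image_of_mem _ hx)

theorem supportFn_half_add {K L : Set E} (hK : IsCompact K) (hL : IsCompact L) (hKne : K.Nonempty)
    (hLne : L.Nonempty) (u : E) :
    supportFn ((1 / 2 : ℝ) • (K + L)) u = (1 / 2) * (supportFn K u + supportFn L u) := by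
  apply le_antisymm
  · refine supportFn_le ((hKne.add hLne).smul_set) ?_
    rintro _ ⟨_, ⟨x, hx, y, hy, rfl⟩, rfl⟩
    simp only [inner_smul_left, inner_add_left, RCLike.conj_to_real]
    gcongr
    · exact inner_le_supportFn hK u hx
    · exact inner_le_supportFn hL u hy
  · obtain ⟨x, hx, hxu⟩ := exists_inner_eq_supportFn hK hKne u
    obtain ⟨y, hy, hyu⟩ := exists_inner_eq_supportFn hL hLne u
    have h1 := inner_le_supportFn ((hK.add hL).smul (1 / 2 : ℝ)) u
      (Set.smul_mem_smul_set (a := (1 / 2 : ℝ)) (Set.add_mem_add hx hy))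
    rw [inner_smul_left, inner_add_left, hxu, hyu] at h1
    simpa using h1

/-- Mazur-Ulam, with translation part `A 0`. -/
theorem IsometryEquiv.exists_eq_linearIsometryEquiv_add (A : E ≃ᵢ E) :
    ∃ (R : E ≃ₗᵢ[ℝ] E) (t : E), ∀ x, A x = R x + t := by
  refine ⟨A.toRealAffineIsometryEquiv.linearIsometryEquiv, A 0, fun x => ?_⟩
  have := A.toRealAffineIsometryEquiv.map_vadd 0 x
  simpa using this

variable [FiniteDimensional ℝ E] [MeasurableSpace E] [BorelSpace E]

/-- The integral of the support function over the unit ball; up to a constant this is the mean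
width. -/
noncomputable def widthIntegral (K : Set E) : ℝ := ∫ u in Metric.ball (0 : E) 1, supportFn K u

theorem integrableOn_ball_of_continuous {f : E → ℝ} (hf : Continuous f) :
    IntegrableOn f (Metric.ball (0 : E) 1) :=
  (hf.continuousOn.integrableOn_compact (isCompact_closedBall 0 1)).mono_set
    Metric.ball_subset_closedBall

theorem setIntegral_ball_comp_linearIsometryEquiv (R : E ≃ₗᵢ[ℝ] E) (f : E → ℝ) :
    ∫ u in Metric.ball (0 : E) 1, f (R u) = ∫ u in Metric.ball (0 : E) 1, f u := by
  have h := R.measurePreserving.setIntegral_preimage_emb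
    R.toHomeomorph.measurableEmbedding f (Metric.ball (0 : E) 1)
  rw [← h]
  congr 2
  ext x
  simp

theorem widthIntegral_image_linearIsometryEquiv (R : E ≃ₗᵢ[ℝ] E) (K : Set E) :
    widthIntegral (R '' K) = widthIntegral K := by
  unfold widthIntegral
  simp only [supportFn_image_linearIsometryEquiv]
  exact setIntegral_ball_comp_linearIsometryEquiv R.symm (supportFn K)

theorem widthIntegral_image_add_const {K : Set E} (hK : IsCompact K) (hne : K.Nonempty) (t : E) :
    widthIntegral ((fun x => x + t) '' K) = widthIntegral K := by
  unfold widthIntegral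
  simp only [supportFn_image_add_const hK hne]
  -- The integrand is odd and the ball is symmetric.
  have h0 : ∫ u in Metric.ball (0 : E) 1, inner ℝ t u = 0 := by
    have h := setIntegral_ball_comp_linearIsometryEquiv (LinearIsometryEquiv.neg ℝ)
      (fun u : E => inner ℝ t u)
    simp only [LinearIsometryEquiv.coe_neg, inner_neg_right, integral_neg] at h
    linarith
  rw [integral_add (integrableOn_ball_of_continuous (continuous_supportFn hK))
    (integrableOn_ball_of_continuous (by fun_prop)), h0, add_zero]

theorem widthIntegral_image_isometryEquiv (A : E ≃ᵢ E) {K : Set E} (hK : IsCompact K)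
    (hne : K.Nonempty) : widthIntegral (A '' K) = widthIntegral K := by
  obtain ⟨R, t, h⟩ := A.exists_eq_linearIsometryEquiv_add
  have : A '' K = (fun x => x + t) '' (R '' K) := by
    rw [image_image]; exact image_congr fun x _ => h x
  rw [this, widthIntegral_image_add_const (hK.image R.continuous) (hne.image _),
    widthIntegral_image_linearIsometryEquiv]

theorem volume_image_isometryEquiv (A : E ≃ᵢ E) (K : Set E) : volume (A '' K) = volume K := by
  obtain ⟨R, t, h⟩ := A.exists_eq_linearIsometryEquiv_add
  have : A '' K = (fun x => x + t) '' (R '' K) := by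
    rw [image_image]; exact image_congr fun x _ => h x
  have hR : R '' K = R.symm ⁻¹' K := R.toEquiv.image_eq_preimage_symm K
  rw [this, image_add_right, measure_preimage_add_right, hR]
  exact R.symm.measurePreserving.measure_preimage_emb R.symm.toHomeomorph.measurableEmbedding K

/-- Support functions are Minkowski-additive and the ball is invariant under `R`; for `R` a
reflection this is the invariance of mean width under Minkowski symmetrization. -/
theorem widthIntegral_half_add_image {K : Set E} (hK : IsCompact K) (hne : K.Nonempty)
    (R : E ≃ₗᵢ[ℝ] E) : widthIntegral ((1 / 2 : ℝ) • (K + R '' K)) = widthIntegral K := by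
  have hRK := hK.image R.continuous
  have h := widthIntegral_image_linearIsometryEquiv R K
  unfold widthIntegral at h ⊢
  simp only [supportFn_half_add hK hRK hne (hne.image _)]
  rw [integral_const_mul, integral_add (integrableOn_ball_of_continuous (continuous_supportFn hK))
    (integrableOn_ball_of_continuous (continuous_supportFn hRK)), h]
  ring

theorem setIntegral_ball_norm_le : ∫ u in Metric.ball (0 : E) 1, ‖u‖ ≤
    (volume (Metric.ball (0 : E) 1)).toReal := by
  have h : ∫ u in Metric.ball (0 : E) 1, ‖u‖ ≤ ∫ _u in Metric.ball (0 : E) 1, (1 : ℝ) := by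
    refine setIntegral_mono_on (integrableOn_ball_of_continuous continuous_norm)
      (integrableOn_ball_of_continuous continuous_const) measurableSet_ball fun u hu => ?_
    exact (mem_ball_zero_iff.1 hu).le
  simpa [Measure.real] using h

theorem widthIntegral_le_add_of_subset_cthickening {K L : Set E} (hK : IsCompact K)
    (hKne : K.Nonempty) (hL : IsCompact L) {δ : ℝ} (hδ : 0 ≤ δ)
    (h : K ⊆ Metric.cthickening δ L) :
    widthIntegral K ≤ widthIntegral L + δ * (volume (Metric.ball (0 : E) 1)).toReal := by
  have h1 : widthIntegral K ≤ ∫ u in Metric.ball (0 : E) 1, (supportFn L u + δ * ‖u‖) :=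
    integral_mono (integrableOn_ball_of_continuous (continuous_supportFn hK))
      (integrableOn_ball_of_continuous ((continuous_supportFn hL).add (by fun_prop)))
      (supportFn_le_add_of_subset_cthickening hKne hL hδ h)
  rw [integral_add (integrableOn_ball_of_continuous (continuous_supportFn hL))
    (integrableOn_ball_of_continuous (by fun_prop)), integral_const_mul] at h1
  have h2 := mul_le_mul_of_nonneg_left (setIntegral_ball_norm_le (E := E)) hδ
  unfold widthIntegral at h1 ⊢
  linarith

/-- If compact sets `L` containing both `K` and `K'` have width integral arbitrarily close to that
of the convex set `K`, then `K' ⊆ K`. -/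
theorem subset_of_forall_exists_widthIntegral_le {K K' : Set E} (hc : Convex ℝ K)
    (hK : IsCompact K) (hne : K.Nonempty) (hK' : IsCompact K') (hne' : K'.Nonempty)
    (h : ∀ δ > 0, ∃ L : Set E, IsCompact L ∧ K ⊆ L ∧ K' ⊆ L ∧
      widthIntegral L ≤ widthIntegral K + δ) : K' ⊆ K := by
  have hcK := continuous_supportFn hK
  have hcK' := continuous_supportFn hK'
  -- The excess of the support function of `K ∪ K'` over that of `K`. It is continuous and
  -- nonnegative, and every admissible `L` bounds its integral, so it vanishes on the ball.
  set g : E → ℝ := fun u => max (supportFn K u) (supportFn K' u) - supportFn K u with hg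
  have hgc : Continuous g := (hcK.max hcK').sub hcK
  have hg0 : ∀ u, 0 ≤ g u := fun u => sub_nonneg.2 (le_max_left _ _)
  have hint : ∫ u in Metric.ball (0 : E) 1, g u = 0 := by
    refine le_antisymm (le_of_forall_pos_le_add fun δ hδ => ?_) (integral_nonneg hg0)
    obtain ⟨L, hL, hKL, hKL', hw⟩ := h δ hδ
    have h1 : ∫ u in Metric.ball (0 : E) 1, max (supportFn K u) (supportFn K' u) ≤
        widthIntegral L :=
      integral_mono (integrableOn_ball_of_continuous (hcK.max hcK'))
        (integrableOn_ball_of_continuous (continuous_supportFn hL))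
        fun u => max_le (supportFn_mono hne hL hKL u) (supportFn_mono hne' hL hKL' u)
    rw [hg, integral_sub (integrableOn_ball_of_continuous (hcK.max hcK'))
      (integrableOn_ball_of_continuous hcK)]
    unfold widthIntegral at h1 hw
    linarith
  have hzero : ∀ u ∈ Metric.ball (0 : E) 1, g u = 0 := by
    rw [setIntegral_eq_zero_iff_of_nonneg_ae (Eventually.of_forall hg0)
      (integrableOn_ball_of_continuous hgc)] at hint
    exact Measure.eqOn_open_of_ae_eq hint Metric.isOpen_ball hgc.continuousOn continuousOn_const
  intro x hx
  refine mem_of_forall_inner_le_supportFn hc hK.isClosed hne fun u => ?_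
  -- Scales `u` into the unit ball; homogeneity undoes the scaling at the end.
  set c : ℝ := (‖u‖ + 1)⁻¹ with hcdef
  have hcpos : 0 < c := by positivity
  have hu : c • u ∈ Metric.ball (0 : E) 1 := by
    rw [mem_ball_zero_iff, norm_smul, Real.norm_of_nonneg hcpos.le, hcdef, inv_mul_lt_iff₀ (by positivity)]
    linarith
  have h1 : supportFn K' (c • u) ≤ supportFn K (c • u) := by
    have h2 := hzero _ hu
    have h3 := le_max_right (supportFn K (c • u)) (supportFn K' (c • u))
    simp only [hg] at h2
    linarith
  have h4 := (inner_le_supportFn hK' (c • u) hx).trans h1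
  obtain ⟨y, hy, hyu⟩ := exists_inner_eq_supportFn hK hne (c • u)
  rw [← hyu, inner_smul_right, inner_smul_right] at h4
  exact (le_of_mul_le_mul_left h4 hcpos).trans (inner_le_supportFn hK u hy)

end SupportFunction

/-! ### The sandwich between fiber and Minkowski symmetrization -/

section Family

variable {n : ℕ} {H : Submodule ℝ (EuclideanSpace ℝ (Fin n))}
  {K : Set (EuclideanSpace ℝ (Fin n))}

theorem reflection_of_mem_orthogonal {x : EuclideanSpace ℝ (Fin n)} (hx : x ∈ Hᗮ) :
    H.reflection x = -x :=
  Submodule.reflection_mem_subspace_orthogonalComplement_eq_neg hx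

theorem isSymmetricWrt_iff : IsSymmetricWrt H K ↔ ∀ x ∈ K, H.reflection x ∈ K := by
  constructor
  · intro h x hx
    rw [← h]
    exact mem_image_of_mem _ hx
  · intro h
    refine Subset.antisymm (by rintro _ ⟨x, hx, rfl⟩; exact h x hx) fun x hx => ?_
    exact ⟨_, h x hx, H.reflection_reflection x⟩

theorem sub_reflection_mem_orthogonal (x : EuclideanSpace ℝ (Fin n)) :
    x - H.reflection x ∈ Hᗮ := by
  rw [Submodule.reflection_apply]
  have : x - (2 • H.starProjection x - x) = (2 : ℝ) • (x - H.starProjection x) := by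
    module
  rw [this]
  exact Hᗮ.smul_mem _ (H.sub_starProjection_mem_orthogonal x)

theorem Convex.half_smul_add_mem (hc : Convex ℝ K) {x y : EuclideanSpace ℝ (Fin n)} (hx : x ∈ K)
    (hy : y ∈ K) : (1 / 2 : ℝ) • (x + y) ∈ K := by
  rw [smul_add]
  exact hc hx hy (by norm_num) (by norm_num) (by norm_num)

theorem mem_minkowskiSymm_iff {z : EuclideanSpace ℝ (Fin n)} :
    z ∈ minkowskiSymm n H K ↔ ∃ a ∈ K, ∃ b ∈ K, z = (1 / 2 : ℝ) • (a + H.reflection b) := by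
  constructor
  · rintro ⟨_, ⟨a, ha, _, ⟨b, hb, rfl⟩, rfl⟩, rfl⟩
    exact ⟨a, ha, b, hb, rfl⟩
  · rintro ⟨a, ha, b, hb, rfl⟩
    exact ⟨_, ⟨a, ha, _, ⟨b, hb, rfl⟩, rfl⟩, rfl⟩

/-- Two points lie over the same base point exactly when they differ by an element of `Hᗮ`, and the
base point is then the projection of either, so it can be eliminated. -/
theorem mem_fiberSymm_iff {z : EuclideanSpace ℝ (Fin n)} :
    z ∈ fiberSymm n H K ↔
      ∃ a ∈ K, ∃ b ∈ K, a - b ∈ Hᗮ ∧ z = (1 / 2 : ℝ) • (a + H.reflection b) := by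
  unfold fiberSymm
  simp only [mem_iUnion, mem_minkowskiSymm_iff, exists_prop]
  constructor
  · rintro ⟨x, -, a, ⟨ha, hax⟩, b, ⟨hb, hbx⟩, rfl⟩
    refine ⟨a, ha, b, hb, ?_, rfl⟩
    have := Hᗮ.sub_mem hax hbx
    rwa [sub_sub_sub_cancel_right] at this
  · rintro ⟨a, ha, b, hb, hab, rfl⟩
    have h1 := H.sub_starProjection_mem_orthogonal a
    refine ⟨H.starProjection a, H.starProjection_apply_mem a, a, ⟨ha, h1⟩, b, ⟨hb, ?_⟩, rfl⟩
    have := Hᗮ.sub_mem h1 hab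
    convert this using 1
    abel

theorem fiberSymm_subset_minkowskiSymm : fiberSymm n H K ⊆ minkowskiSymm n H K := by
  intro z hz
  obtain ⟨a, ha, b, hb, -, rfl⟩ := mem_fiberSymm_iff.1 hz
  exact mem_minkowskiSymm_iff.2 ⟨a, ha, b, hb, rfl⟩

theorem minkowskiSymm_mono {L : Set (EuclideanSpace ℝ (Fin n))} (h : K ⊆ L) :
    minkowskiSymm n H K ⊆ minkowskiSymm n H L := by
  intro z hz
  obtain ⟨a, ha, b, hb, rfl⟩ := mem_minkowskiSymm_iff.1 hz
  exact mem_minkowskiSymm_iff.2 ⟨a, h ha, b, h hb, rfl⟩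

theorem fiberSymm_mono {L : Set (EuclideanSpace ℝ (Fin n))} (h : K ⊆ L) :
    fiberSymm n H K ⊆ fiberSymm n H L := by
  intro z hz
  obtain ⟨a, ha, b, hb, hab, rfl⟩ := mem_fiberSymm_iff.1 hz
  exact mem_fiberSymm_iff.2 ⟨a, h ha, b, h hb, hab, rfl⟩

theorem reflection_half_smul_add_reflection (a b : EuclideanSpace ℝ (Fin n)) :
    H.reflection ((1 / 2 : ℝ) • (a + H.reflection b)) =
      (1 / 2 : ℝ) • (b + H.reflection a) := by
  rw [map_smul, map_add, Submodule.reflection_reflection, add_comm]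

theorem isSymmetrizationAt_minkowskiSymm : IsSymmetrizationAt (minkowskiSymm n H) H := by
  rintro K ⟨hc, hK, hne⟩
  refine ⟨⟨(hc.add (hc.linear_image H.reflection.toLinearMap)).smul _,
    (hK.add (hK.image H.reflection.continuous)).smul _, (hne.add (hne.image _)).smul_set⟩, ?_⟩
  rw [isSymmetricWrt_iff]
  intro z hz
  obtain ⟨a, ha, b, hb, rfl⟩ := mem_minkowskiSymm_iff.1 hz
  exact mem_minkowskiSymm_iff.2 ⟨b, hb, a, ha, reflection_half_smul_add_reflection a b⟩

theorem fiberSymm_eq_image : fiberSymm n H K =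
    (fun p : EuclideanSpace ℝ (Fin n) × EuclideanSpace ℝ (Fin n) =>
      (1 / 2 : ℝ) • (p.1 + H.reflection p.2)) '' ((K ×ˢ K) ∩ {p | p.1 - p.2 ∈ Hᗮ}) := by
  ext z
  rw [mem_fiberSymm_iff]
  constructor
  · rintro ⟨a, ha, b, hb, hab, rfl⟩
    exact ⟨(a, b), ⟨⟨ha, hb⟩, hab⟩, rfl⟩
  · rintro ⟨⟨a, b⟩, ⟨⟨ha, hb⟩, hab⟩, rfl⟩
    exact ⟨a, ha, b, hb, hab, rfl⟩

theorem isCompact_fiberSymm (hK : IsCompact K) : IsCompact (fiberSymm n H K) := by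
  rw [fiberSymm_eq_image]
  refine ((hK.prod hK).inter_right ?_).image ?_
  · exact (Submodule.closed_of_finiteDimensional Hᗮ).preimage (by fun_prop)
  · have := H.reflection.continuous
    fun_prop

theorem isSymmetrizationAt_fiberSymm : IsSymmetrizationAt (fiberSymm n H) H := by
  rintro K ⟨hc, hK, hne⟩
  refine ⟨⟨?_, isCompact_fiberSymm hK, ?_⟩, ?_⟩
  · intro x hx y hy s t hs ht hst
    obtain ⟨a, ha, b, hb, hab, rfl⟩ := mem_fiberSymm_iff.1 hx
    obtain ⟨a', ha', b', hb', hab', rfl⟩ := mem_fiberSymm_iff.1 hy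
    refine mem_fiberSymm_iff.2 ⟨s • a + t • a', hc ha ha' hs ht hst, s • b + t • b',
      hc hb hb' hs ht hst, ?_, ?_⟩
    · have := Hᗮ.add_mem (Hᗮ.smul_mem s hab) (Hᗮ.smul_mem t hab')
      convert this using 1
      module
    · rw [map_add, map_smul, map_smul]
      module
  · obtain ⟨a, ha⟩ := hne
    exact ⟨_, mem_fiberSymm_iff.2 ⟨a, ha, a, ha, by simp, rfl⟩⟩
  · rw [isSymmetricWrt_iff]
    intro z hz
    obtain ⟨a, ha, b, hb, hab, rfl⟩ := mem_fiberSymm_iff.1 hz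
    refine mem_fiberSymm_iff.2 ⟨b, hb, a, ha, ?_, reflection_half_smul_add_reflection a b⟩
    rw [← neg_sub]
    exact Hᗮ.neg_mem hab

theorem minkowskiSymm_vadd_subset (hc : Convex ℝ K) (hs : IsSymmetricWrt H K)
    {x : EuclideanSpace ℝ (Fin n)} (hx : x ∈ Hᗮ) : minkowskiSymm n H (x +ᵥ K) ⊆ K := by
  intro z hz
  obtain ⟨_, ⟨a, ha, rfl⟩, _, ⟨b, hb, rfl⟩, rfl⟩ := mem_minkowskiSymm_iff.1 hz
  have h : (x +ᵥ a) + H.reflection (x +ᵥ b) = a + H.reflection b := by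
    simp only [vadd_eq_add, map_add, reflection_of_mem_orthogonal hx]
    abel
  change (1 / 2 : ℝ) • ((x +ᵥ a) + H.reflection (x +ᵥ b)) ∈ K
  rw [h]
  exact hc.half_smul_add_mem ha (isSymmetricWrt_iff.1 hs b hb)

theorem subset_fiberSymm_vadd (hs : IsSymmetricWrt H K)
    {x : EuclideanSpace ℝ (Fin n)} (hx : x ∈ Hᗮ) : K ⊆ fiberSymm n H (x +ᵥ K) := by
  intro z hz
  refine mem_fiberSymm_iff.2 ⟨x +ᵥ z, vadd_mem_vadd_set hz, x +ᵥ H.reflection z,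
    vadd_mem_vadd_set (isSymmetricWrt_iff.1 hs z hz), ?_, ?_⟩
  · simpa using sub_reflection_mem_orthogonal z
  · simp only [vadd_eq_add, map_add, reflection_of_mem_orthogonal hx,
      Submodule.reflection_reflection]
    module

/-- Everything comes from the chain `K ⊆ F_H (x + K) ⊆ M_H (x + K) ⊆ K` for symmetric `K` and `x ∈
Hᗮ`, with `x = 0` for invariance; the same chain serves fiber symmetrization. -/
theorem inFamilyF_minkowskiSymm (𝒢 : Set (Submodule ℝ (EuclideanSpace ℝ (Fin n)))) :
    InFamilyF 𝒢 (minkowskiSymm n) where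
  isSymmetrization _ _ := isSymmetrizationAt_minkowskiSymm
  monotone _ _ _ _ _ _ h := minkowskiSymm_mono h
  translation_invariant _ _ _ hK hs _ hx := Subset.antisymm (minkowskiSymm_vadd_subset hK.1 hs hx)
    ((subset_fiberSymm_vadd hs hx).trans fiberSymm_subset_minkowskiSymm)
  invariant H _ K hK hs := by
    have h := Subset.antisymm (minkowskiSymm_vadd_subset hK.1 hs (zero_mem Hᗮ))
      ((subset_fiberSymm_vadd hs (zero_mem Hᗮ)).trans fiberSymm_subset_minkowskiSymm)
    rwa [zero_vadd] at h

theorem inFamilyF_fiberSymm (𝒢 : Set (Submodule ℝ (EuclideanSpace ℝ (Fin n)))) :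
    InFamilyF 𝒢 (fiberSymm n) where
  isSymmetrization _ _ := isSymmetrizationAt_fiberSymm
  monotone _ _ _ _ _ _ h := fiberSymm_mono h
  translation_invariant _ _ _ hK hs _ hx := Subset.antisymm
    (fiberSymm_subset_minkowskiSymm.trans (minkowskiSymm_vadd_subset hK.1 hs hx))
    (subset_fiberSymm_vadd hs hx)
  invariant H _ K hK hs := by
    have h := Subset.antisymm
      (fiberSymm_subset_minkowskiSymm.trans (minkowskiSymm_vadd_subset hK.1 hs (zero_mem Hᗮ)))
      (subset_fiberSymm_vadd hs (zero_mem Hᗮ))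
    rwa [zero_vadd] at h

variable {𝒢 : Set (Submodule ℝ (EuclideanSpace ℝ (Fin n)))} {S : SetTransform n}

/-- If `a`, `b` lie in one fiber and `m = (a + R b) / 2`, the segment from `a` to `b` is the
translate by `a - m ∈ Hᗮ` of the symmetric segment from `m` to `R m`. Translation invariance and
monotonicity then put `m` in `S H K`. -/
theorem InFamilyF.fiberSymm_subset (hS : InFamilyF 𝒢 S) (hH : H ∈ 𝒢) (hK : K ∈ convexCompacts n) :
    fiberSymm n H K ⊆ S H K := by
  intro z hz
  obtain ⟨a, ha, b, hb, hab, rfl⟩ := mem_fiberSymm_iff.1 hz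
  set m : EuclideanSpace ℝ (Fin n) := (1 / 2 : ℝ) • (a + H.reflection b) with hm
  set y : EuclideanSpace ℝ (Fin n) := a - m with hy
  have hb' := sub_reflection_mem_orthogonal (H := H) b
  have hyH : y ∈ Hᗮ := by
    have : y = (1 / 2 : ℝ) • ((a - b) + (b - H.reflection b)) := by
      rw [hy, hm]; module
    rw [this]
    exact Hᗮ.smul_mem _ (Hᗮ.add_mem hab hb')
  have hRm : H.reflection m = b - y := by
    have h1 := reflection_of_mem_orthogonal hab
    rw [map_sub, sub_eq_iff_eq_add] at h1
    rw [hm, reflection_half_smul_add_reflection, h1, hy, hm]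
    have h2 := reflection_of_mem_orthogonal hab
    module
  have hL : segment ℝ m (H.reflection m) ∈ convexCompacts n :=
    ⟨convex_segment _ _, by
      rw [← convexHull_pair (𝕜 := ℝ)]; exact (Set.toFinite _).isCompact_convexHull (𝕜 := ℝ),
      ⟨m, left_mem_segment ℝ _ _⟩⟩
  have hLs : IsSymmetricWrt H (segment ℝ m (H.reflection m)) := by
    unfold IsSymmetricWrt
    have := image_segment ℝ (H.reflection.toLinearEquiv.toLinearMap.toAffineMap) m (H.reflection m)
    simp only [LinearMap.coe_toAffineMap, LinearEquiv.coe_coe,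
      LinearIsometryEquiv.coe_toLinearEquiv, Submodule.reflection_reflection] at this
    rw [this, segment_symm]
  have hsub : y +ᵥ segment ℝ m (H.reflection m) ⊆ K := by
    rintro _ ⟨w, ⟨s, t, hs, ht, hst, rfl⟩, rfl⟩
    have : y +ᵥ (s • m + t • H.reflection m) = s • a + t • b := by
      rw [vadd_eq_add, hRm, hy]
      have : s = 1 - t := by linarith
      subst this
      module
    change y +ᵥ (s • m + t • H.reflection m) ∈ K
    rw [this]
    exact hK.1 ha hb hs ht hst
  have hcy : y +ᵥ segment ℝ m (H.reflection m) ∈ convexCompacts n :=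
    ⟨hL.1.vadd y, hL.2.1.vadd y, hL.2.2.vadd_set⟩
  have h := hS.monotone H hH _ hcy K hK hsub
  rw [hS.translation_invariant H hH _ hL hLs y hyH] at h
  exact h (left_mem_segment ℝ _ _)

/-- A suitable multiple of `u - R u` works. If `R u = u`, then `u` is orthogonal to `Hᗮ` and only `d
= 0` is attainable. The vector serves to balance the support values of `K` at `u` and `R u`. -/
theorem exists_mem_orthogonal_inner_eq (u : EuclideanSpace ℝ (Fin n)) (d : ℝ)
    (hd : H.reflection u = u → d = 0) : ∃ y ∈ Hᗮ, inner ℝ y u = d := by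
  by_cases h : H.reflection u = u
  · exact ⟨0, zero_mem _, by simp [hd h]⟩
  · set w := u - H.reflection u with hw
    have hwH : w ∈ Hᗮ := sub_reflection_mem_orthogonal u
    have hne : inner ℝ w w ≠ (0 : ℝ) := by
      rw [inner_self_ne_zero]
      exact fun h0 => h (sub_eq_zero.1 h0).symm
    have hwu : 2 * inner ℝ w u = (inner ℝ w w : ℝ) := by
      have h1 : inner ℝ w (H.reflection u) = (-inner ℝ w u : ℝ) := by
        rw [← H.reflection.inner_map_map, Submodule.reflection_reflection,
          reflection_of_mem_orthogonal hwH, inner_neg_left]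
      conv_rhs => rw [hw, inner_sub_right, ← hw, h1]
      ring
    refine ⟨(2 * d / inner ℝ w w) • w, Hᗮ.smul_mem _ hwH, ?_⟩
    rw [inner_smul_left]
    simp only [RCLike.conj_to_real]
    rw [show (inner ℝ w u : ℝ) = inner ℝ w w / 2 by linarith]
    field_simp

theorem isSymmetricWrt_closedBall (r : ℝ) :
    IsSymmetricWrt H (Metric.closedBall (0 : EuclideanSpace ℝ (Fin n)) r) := by
  rw [isSymmetricWrt_iff]
  intro x hx
  simpa using hx

/-- For each `u`, a translation in `Hᗮ` brings the supporting half-spaces of `K` with normals `u`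
and `R u` to the common level `c`, the support value of `M_H K` at `u`. Their intersection is
symmetric, so monotonicity and translation invariance confine `S H K` to it. -/
theorem InFamilyF.subset_minkowskiSymm (hS : InFamilyF 𝒢 S) (hH : H ∈ 𝒢)
    (hK : K ∈ convexCompacts n) : S H K ⊆ minkowskiSymm n H K := by
  intro p hp
  obtain ⟨hMc, hMK, hMne⟩ := (isSymmetrizationAt_minkowskiSymm (H := H) K hK).1
  refine mem_of_forall_inner_le_supportFn hMc hMK.isClosed hMne fun u => ?_
  have hR : H.reflection.symm = H.reflection := H.reflection_symm
  have hMu : supportFn (minkowskiSymm n H K) u =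
      1 / 2 * (supportFn K u + supportFn K (H.reflection u)) := by
    unfold minkowskiSymm
    rw [supportFn_half_add hK.2.1 (hK.2.1.image H.reflection.continuous) hK.2.2
      (hK.2.2.image _), supportFn_image_linearIsometryEquiv, hR]
  set c := 1 / 2 * (supportFn K u + supportFn K (H.reflection u)) with hc
  rw [hMu]
  obtain ⟨y, hyH, hyu⟩ := exists_mem_orthogonal_inner_eq (H := H) u
    (1 / 2 * (supportFn K u - supportFn K (H.reflection u))) (fun h => by rw [h]; ring)
  have hyRu : inner ℝ y (H.reflection u) =
      -(1 / 2 * (supportFn K u - supportFn K (H.reflection u))) := by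
    rw [← H.reflection.inner_map_map, Submodule.reflection_reflection,
      reflection_of_mem_orthogonal hyH, inner_neg_left, hyu]
  -- Intersecting with a symmetric ball makes the region compact; radius `r + ‖y‖` leaves room for
  -- `K` translated by `-y`.
  obtain ⟨r, hr⟩ := hK.2.1.isBounded.subset_closedBall (0 : EuclideanSpace ℝ (Fin n))
  set L : Set (EuclideanSpace ℝ (Fin n)) := Metric.closedBall 0 (r + ‖y‖) ∩
    {z | inner ℝ z u ≤ c ∧ inner ℝ z (H.reflection u) ≤ c} with hLdef
  have hKL : K ⊆ y +ᵥ L := by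
    intro x hx
    refine ⟨x - y, ⟨?_, ?_, ?_⟩, by simp⟩
    · rw [mem_closedBall_zero_iff]
      exact (norm_sub_le _ _).trans (by gcongr; exact mem_closedBall_zero_iff.1 (hr hx))
    · have := inner_le_supportFn hK.2.1 u hx
      rw [inner_sub_left, hyu]
      linarith
    · have := inner_le_supportFn hK.2.1 (H.reflection u) hx
      rw [inner_sub_left, hyRu]
      linarith
  have hLs : IsSymmetricWrt H L := by
    rw [isSymmetricWrt_iff]
    rintro z ⟨hz1, hz2, hz3⟩
    refine ⟨isSymmetricWrt_iff.1 (isSymmetricWrt_closedBall _) z hz1, ?_, ?_⟩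
    · rw [← H.reflection.inner_map_map, Submodule.reflection_reflection]
      exact hz3
    · rwa [H.reflection.inner_map_map]
  have hLcl : IsClosed {z : EuclideanSpace ℝ (Fin n) |
      inner ℝ z u ≤ c ∧ inner ℝ z (H.reflection u) ≤ c} := by
    have h1 : ∀ v : EuclideanSpace ℝ (Fin n),
        IsClosed {z : EuclideanSpace ℝ (Fin n) | inner ℝ z v ≤ c} :=
      fun v => isClosed_le (by fun_prop) continuous_const
    exact (h1 u).inter (h1 _)
  have hhalf : ∀ v : EuclideanSpace ℝ (Fin n),
      Convex ℝ {z : EuclideanSpace ℝ (Fin n) | inner ℝ z v ≤ c} := by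
    intro v
    exact convex_halfSpace_le ⟨fun x y => inner_add_left x y v,
      fun a x => by simp [inner_smul_left]⟩ c
  have hL : L ∈ convexCompacts n := by
    refine ⟨(convex_closedBall _ _).inter ((hhalf u).inter (hhalf _)),
      (isCompact_closedBall _ _).inter_right hLcl, ?_⟩
    obtain ⟨x, hx⟩ := hK.2.2
    obtain ⟨z, hz, -⟩ := hKL hx
    exact ⟨z, hz⟩
  have h := hS.monotone H hH K hK _ ⟨hL.1.vadd y, hL.2.1.vadd y, hL.2.2.vadd_set⟩ hKL
  rw [hS.translation_invariant H hH L hL hLs y hyH] at h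
  exact (h hp).2.1

theorem InFamilyF.subset_closedBall (hS : InFamilyF 𝒢 S) (hH : H ∈ 𝒢)
    (hK : K ∈ convexCompacts n) {r : ℝ} (hr : 0 ≤ r) (hKr : K ⊆ Metric.closedBall 0 r) :
    S H K ⊆ Metric.closedBall 0 r := by
  have hB : Metric.closedBall (0 : EuclideanSpace ℝ (Fin n)) r ∈ convexCompacts n :=
    ⟨convex_closedBall _ _, isCompact_closedBall _ _, ⟨0, by simpa⟩⟩
  have h := hS.monotone H hH K hK _ hB hKr
  rwa [hS.invariant H hH _ hB (isSymmetricWrt_closedBall r)] at h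

theorem InFamilyF.zero (hS : InFamilyF 𝒢 S) (hH : H ∈ 𝒢) : S H {0} = {0} :=
  hS.invariant H hH _ ⟨convex_singleton 0, isCompact_singleton, singleton_nonempty 0⟩
    (by simp [IsSymmetricWrt])

end Family

/-! ### Volume under symmetrization -/

section Volume

variable {n : ℕ} {H : Submodule ℝ (EuclideanSpace ℝ (Fin n))}
  {K : Set (EuclideanSpace ℝ (Fin n))}

theorem measurePreserving_add_orthogonal (H : Submodule ℝ (EuclideanSpace ℝ (Fin n))) :
    MeasurePreserving (fun p : H × Hᗮ => (p.1 : EuclideanSpace ℝ (Fin n)) + p.2) := by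
  have h := (LinearIsometryEquiv.measurePreserving H.orthogonalDecomposition.symm).comp
    (WithLp.volume_preserving_toLp H Hᗮ)
  convert! h using 1

theorem volume_eq_lintegral_section (hK : MeasurableSet K) :
    volume K = ∫⁻ p : H, volume {v : Hᗮ | (p : EuclideanSpace ℝ (Fin n)) + v ∈ K} := by
  have h := measurePreserving_add_orthogonal H
  rw [← h.measure_preimage hK.nullMeasurableSet, Measure.volume_eq_prod,
    Measure.prod_apply (h.measurable hK)]
  rfl

theorem measurableSet_section (hK : MeasurableSet K) (p : H) :
    MeasurableSet {v : Hᗮ | (p : EuclideanSpace ℝ (Fin n)) + v ∈ K} :=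
  hK.preimage (by fun_prop : Measurable fun v : Hᗮ => (p : EuclideanSpace ℝ (Fin n)) + v)

/-- Fiber symmetrization does not decrease the volume. -/
theorem volume_le_volume_fiberSymm (hK : IsCompact K) : volume K ≤ volume (fiberSymm n H K) := by
  have hF := (isCompact_fiberSymm (H := H) hK).measurableSet
  rw [volume_eq_lintegral_section (H := H) hK.measurableSet,
    volume_eq_lintegral_section (H := H) hF]
  -- Fubini over `H`: the reflection acts as `v ↦ -v` in each fiber, so the new section contains the
  -- central Minkowski symmetral of the old one.
  refine lintegral_mono fun p => volume_le_volume_of_half_sub_mem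
    (measurableSet_section hK.measurableSet p) (measurableSet_section hF p) ?_
  intro a ha b hb
  refine mem_fiberSymm_iff.2 ⟨_, ha, _, hb, ?_, ?_⟩
  · rw [add_sub_add_left_eq_sub]
    exact Hᗮ.sub_mem a.2 b.2
  · rw [map_add, reflection_of_mem_orthogonal b.2, Submodule.reflection_mem_subspace_eq_self p.2]
    push_cast
    module

theorem InFamilyF.volume_le {𝒢 : Set (Submodule ℝ (EuclideanSpace ℝ (Fin n)))} {S : SetTransform n}
    (hS : InFamilyF 𝒢 S) (hH : H ∈ 𝒢) (hK : K ∈ convexCompacts n) :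
    volume K ≤ volume (S H K) :=
  (volume_le_volume_fiberSymm hK.2.1).trans (measure_mono (hS.fiberSymm_subset hH hK))

end Volume

/-! ### Steiner symmetrization as fiber symmetrization -/

section Steiner

variable {n : ℕ} {H : Submodule ℝ (EuclideanSpace ℝ (Fin n))}
  {K : Set (EuclideanSpace ℝ (Fin n))}

theorem IsHyperplane.exists_orthogonal_eq_span (hH : IsHyperplane H) :
    ∃ e : EuclideanSpace ℝ (Fin n), ‖e‖ = 1 ∧ ∀ y, y ∈ Hᗮ ↔ ∃ t : ℝ, y = t • e := by
  have h1 : Module.finrank ℝ Hᗮ = 1 := by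
    have h2 := H.finrank_add_finrank_orthogonal
    rw [finrank_euclideanSpace_fin] at h2
    unfold IsHyperplane at hH
    omega
  obtain ⟨v, hv0, hv⟩ := finrank_eq_one_iff'.1 h1
  have hv0' : (v : EuclideanSpace ℝ (Fin n)) ≠ 0 := by simpa using hv0
  have hn : ‖(v : EuclideanSpace ℝ (Fin n))‖ ≠ 0 := norm_ne_zero_iff.2 hv0'
  refine ⟨‖(v : EuclideanSpace ℝ (Fin n))‖⁻¹ • v, ?_, fun y => ⟨fun hy => ?_, ?_⟩⟩
  · rw [norm_smul, norm_inv, norm_norm, inv_mul_cancel₀ hn]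
  · obtain ⟨c, hc⟩ := hv ⟨y, hy⟩
    refine ⟨c * ‖(v : EuclideanSpace ℝ (Fin n))‖, ?_⟩
    rw [smul_smul, mul_assoc, mul_inv_cancel₀ hn, mul_one]
    exact (congrArg Subtype.val hc).symm
  · rintro ⟨t, rfl⟩
    exact Hᗮ.smul_mem _ (Hᗮ.smul_mem _ v.2)

/-- On compact convex sets, Steiner symmetrization is fiber symmetrization in a hyperplane. -/
theorem steinerSymm_eq_fiberSymm (hH : IsHyperplane H) (hK : K ∈ convexCompacts n) :
    steinerSymm n H K = fiberSymm n H K := by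
  obtain ⟨e, he, hspan⟩ := hH.exists_orthogonal_eq_span
  have heH : e ∈ Hᗮ := (hspan e).2 ⟨1, by simp⟩
  have key : ∀ x ∈ H, (orthSection H K x).Nonempty → ∀ y,
      (y ∈ minkowskiSymm n H (orthSection H K x) ↔ y - x ∈ Hᗮ ∧
        ‖y - x‖ ≤ (Measure.hausdorffMeasure 1 (orthSection H K x)).toReal / 2) := by
    intro x hx hne y
    -- Isometric parametrization of the fiber line through `x`; it turns the section into a compact
    -- interval and Hausdorff measure into its length.
    set φ : ℝ → EuclideanSpace ℝ (Fin n) := fun t => x + t • e with hφ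
    have hiso : Isometry φ := Isometry.of_dist_eq fun s t => by
      rw [hφ, dist_add_left, dist_eq_norm, ← sub_smul, norm_smul, he, mul_one, Real.dist_eq,
        Real.norm_eq_abs]
    set I : Set ℝ := φ ⁻¹' K with hI
    have hsec : orthSection H K x = φ '' I := by
      ext z
      constructor
      · rintro ⟨hzK, hz⟩
        obtain ⟨t, ht⟩ := (hspan _).1 hz
        have hz' : φ t = z := by rw [hφ]; simp only; rw [← ht]; abel
        exact ⟨t, by rw [hI, mem_preimage, hz']; exact hzK, hz'⟩
      · rintro ⟨t, ht, rfl⟩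
        refine ⟨ht, (hspan _).2 ⟨t, by simp [hφ]⟩⟩
    have hIne : I.Nonempty := by rw [hsec] at hne; exact hne.of_image
    have hIK : IsCompact I := hiso.isClosedEmbedding.isCompact_preimage hK.2.1
    have hIc : Convex ℝ I := by
      have : φ = AffineMap.lineMap x (x + e) := by
        ext1 t
        simp [hφ, AffineMap.lineMap_apply, add_comm]
      rw [hI, this]
      exact hK.1.affine_preimage _
    obtain ⟨a, b, hab, hIab⟩ : ∃ a b : ℝ, a ≤ b ∧ I = Icc a b := by
      refine ⟨sInf I, sSup I, Real.sInf_le_sSup _ hIK.bddBelow hIK.bddAbove, ?_⟩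
      exact eq_Icc_of_connected_compact ⟨hIne, hIc.isPreconnected⟩ hIK
    have hlen : (Measure.hausdorffMeasure 1 (orthSection H K x)).toReal = b - a := by
      rw [hsec, hiso.hausdorffMeasure_image (Or.inl zero_le_one), hausdorffMeasure_real, hIab,
        Real.volume_Icc, ENNReal.toReal_ofReal (by linarith)]
    have hRφ : ∀ t, H.reflection (φ t) = x - t • e := fun t => by
      rw [hφ]
      simp only
      rw [map_add, Submodule.reflection_mem_subspace_eq_self hx, map_smul,
        reflection_of_mem_orthogonal heH]
      module
    rw [hlen, hsec, mem_minkowskiSymm_iff]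
    constructor
    · rintro ⟨_, ⟨s, hs, rfl⟩, _, ⟨t, ht, rfl⟩, rfl⟩
      rw [hRφ]
      have : (1 / 2 : ℝ) • (φ s + (x - t • e)) - x = ((s - t) / 2) • e := by
        rw [hφ]; module
      rw [this, norm_smul, he, mul_one, Real.norm_eq_abs, abs_le]
      rw [hIab] at hs ht
      refine ⟨Hᗮ.smul_mem _ heH, ?_, ?_⟩ <;> linarith [hs.1, hs.2, ht.1, ht.2]
    · rintro ⟨hy, hyn⟩
      obtain ⟨t, ht⟩ := (hspan _).1 hy
      rw [ht, norm_smul, he, mul_one, Real.norm_eq_abs, abs_le] at hyn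
      -- The parameters `(a + b) / 2 ± t` have half-difference `t` and lie in `[a, b]` exactly when
      -- `|t| ≤ (b - a) / 2`.
      refine ⟨_, ⟨(a + b) / 2 + t, ?_, rfl⟩, _, ⟨(a + b) / 2 - t, ?_, rfl⟩, ?_⟩
      · rw [hIab]; constructor <;> linarith [hyn.1, hyn.2]
      · rw [hIab]; constructor <;> linarith [hyn.1, hyn.2]
      · rw [hRφ, eq_add_of_sub_eq ht, hφ]
        module
  ext y
  unfold fiberSymm
  simp only [mem_iUnion, exists_prop]
  constructor
  · rintro ⟨x, hx, hne, h⟩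
    exact ⟨x, hx, (key x hx hne y).2 h⟩
  · rintro ⟨x, hx, h⟩
    have hne : (orthSection H K x).Nonempty := by
      obtain ⟨a, ha, -⟩ := mem_minkowskiSymm_iff.1 h
      exact ⟨a, ha⟩
    exact ⟨x, hx, hne, (key x hx hne y).1 h⟩

end Steiner

/-! ### Cluster points in the Hausdorff distance -/

section HausdorffClusterPt

open Metric TopologicalSpace

/-- `L` is a cluster point, in the Hausdorff distance, of the sequence of sets `Q`. -/
def IsHausdorffClusterPt {X : Type*} [PseudoEMetricSpace X] (Q : ℕ → Set X) (L : Set X) : Prop :=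
  ∀ δ : ℝ, 0 < δ → ∃ᶠ j in atTop, hausdorffEDist (Q j) L < ENNReal.ofReal δ

variable {X : Type*}

section PseudoEMetricSpace

variable [PseudoEMetricSpace X]

theorem subset_cthickening_of_hausdorffEDist_lt {K L : Set X} {δ : ℝ}
    (h : hausdorffEDist K L < ENNReal.ofReal δ) : K ⊆ cthickening δ L := fun _ hx =>
  (infEDist_le_hausdorffEDist_of_mem hx).trans h.le

theorem subset_cthickening_of_hausdorffEDist_lt' {K L : Set X} {δ : ℝ}
    (h : hausdorffEDist K L < ENNReal.ofReal δ) : L ⊆ cthickening δ K :=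
  subset_cthickening_of_hausdorffEDist_lt (by rwa [hausdorffEDist_comm])

theorem IsHausdorffClusterPt.comp_add_left {Q : ℕ → Set X} {L : Set X}
    (h : IsHausdorffClusterPt Q L) (j : ℕ) : IsHausdorffClusterPt (fun i => Q (j + i)) L := by
  intro δ hδ
  rw [frequently_atTop]
  intro a
  obtain ⟨b, hb, hQ⟩ := frequently_atTop.1 (h δ hδ) (j + a)
  refine ⟨b - j, by omega, ?_⟩
  simpa only [show j + (b - j) = b by omega] using hQ

theorem eventually_hausdorffEDist_lt {Y : ℕ → Set X} {L : Set X}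
    (h : Tendsto (fun i => hausdorffEDist (Y i) L) atTop (𝓝 0)) {δ : ℝ} (hδ : 0 < δ) :
    ∀ᶠ i in atTop, hausdorffEDist (Y i) L < ENNReal.ofReal δ :=
  h.eventually_lt_const (ENNReal.ofReal_pos.2 hδ)

/-- `Y` is close to `L` eventually and `Q` is close to `C` frequently, so some index serves both.
Thus one limit `L` can be compared with every cluster point of `Q`. -/
theorem IsHausdorffClusterPt.limit_subset_cthickening {Y Q : ℕ → Set X} {L C : Set X}
    (hC : IsHausdorffClusterPt Q C) (hY : Tendsto (fun i => hausdorffEDist (Y i) L) atTop (𝓝 0))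
    {ε : ℝ} (hε : 0 ≤ ε) (hYQ : ∀ i, Y i ⊆ cthickening ε (Q i)) : L ⊆ cthickening ε C := by
  rw [cthickening_eq_iInter_cthickening]
  refine subset_iInter₂ fun δ hδ => ?_
  -- Chosen so that the two approximation errors and `ε` add up to `δ`.
  set η : ℝ := (δ - ε) / 2 with hη
  have hη0 : 0 < η := by rw [hη]; linarith
  obtain ⟨i, hi1, hi2⟩ := ((hC η hη0).and_eventually (eventually_hausdorffEDist_lt hY hη0)).exists
  calc L ⊆ cthickening η (Y i) := subset_cthickening_of_hausdorffEDist_lt' hi2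
    _ ⊆ cthickening η (cthickening ε (cthickening η C)) :=
        cthickening_subset_of_subset _ ((hYQ i).trans (cthickening_subset_of_subset _
          (subset_cthickening_of_hausdorffEDist_lt hi1)))
    _ ⊆ cthickening η (cthickening (ε + η) C) :=
        cthickening_subset_of_subset _ (cthickening_cthickening_subset hε hη0.le _)
    _ ⊆ cthickening (η + (ε + η)) C := cthickening_cthickening_subset hη0.le (by positivity) _
    _ = cthickening δ C := by congr 1; rw [hη]; ring

theorem IsHausdorffClusterPt.subset_limit {Y Q : ℕ → Set X} {L C : Set X}
    (hC : IsHausdorffClusterPt Q C) (hY : Tendsto (fun i => hausdorffEDist (Y i) L) atTop (𝓝 0))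
    (hL : IsClosed L) (hQY : ∀ i, Q i ⊆ Y i) : C ⊆ L := by
  rw [← hL.closure_eq, closure_eq_iInter_cthickening]
  refine subset_iInter₂ fun δ hδ => ?_
  have hη0 : 0 < δ / 2 := by linarith
  obtain ⟨i, hi1, hi2⟩ :=
    ((hC _ hη0).and_eventually (eventually_hausdorffEDist_lt hY hη0)).exists
  calc C ⊆ cthickening (δ / 2) (Q i) := subset_cthickening_of_hausdorffEDist_lt' hi1
    _ ⊆ cthickening (δ / 2) (cthickening (δ / 2) L) := cthickening_subset_of_subset _
        ((hQY i).trans (subset_cthickening_of_hausdorffEDist_lt hi2))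
    _ ⊆ cthickening (δ / 2 + δ / 2) L := cthickening_cthickening_subset hη0.le hη0.le _
    _ = cthickening δ L := by rw [add_halves]

end PseudoEMetricSpace

theorem IsHausdorffClusterPt.convex [NormedAddCommGroup X] [NormedSpace ℝ X] {Q : ℕ → Set X}
    {C : Set X} (hC : IsHausdorffClusterPt Q C) (hCcl : IsClosed C) (hQ : ∀ j, Convex ℝ (Q j)) :
    Convex ℝ C := by
  intro x hx y hy a b ha hb hab
  rw [← hCcl.closure_eq, closure_eq_iInter_cthickening]
  refine mem_iInter₂.2 fun δ hδ => ?_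
  have hη0 : 0 < δ / 2 := by linarith
  obtain ⟨i, hi⟩ := (hC _ hη0).exists
  have h1 := subset_cthickening_of_hausdorffEDist_lt' hi
  have h2 := (hQ i).cthickening (δ / 2) (h1 hx) (h1 hy) ha hb hab
  have h3 := cthickening_cthickening_subset hη0.le hη0.le _
    (cthickening_subset_of_subset _ (subset_cthickening_of_hausdorffEDist_lt hi) h2)
  rwa [add_halves] at h3

/-- Blaschke selection: the compact subsets of a compact set form a compact set. -/
theorem isCompact_nonemptyCompacts_subset [MetricSpace X] [CompleteSpace X] {B : Set X}
    (hB : IsCompact B) : IsCompact {K : NonemptyCompacts X | (K : Set X) ⊆ B} :=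
  (NonemptyCompacts.totallyBounded_subsets_of_totallyBounded hB.totallyBounded).isCompact_of_isClosed
    (NonemptyCompacts.isClosed_subsets_of_isClosed hB.isClosed)

/-- A bounded sequence of convex compact sets converges as soon as it has at most one cluster
point. -/
theorem exists_tendsto_of_forall_clusterPt_subset {n : ℕ}
    {Q : ℕ → Set (EuclideanSpace ℝ (Fin n))} (hQ : ∀ j, Q j ∈ convexCompacts n)
    {r : ℝ} (hr : ∀ᶠ j in atTop, Q j ⊆ closedBall 0 r)
    (huniq : ∀ C ∈ convexCompacts n, ∀ C' ∈ convexCompacts n, IsHausdorffClusterPt Q C →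
      IsHausdorffClusterPt Q C' → C ⊆ C') :
    ∃ L ∈ convexCompacts n, Tendsto (fun j => hausdorffEDist (Q j) L) atTop (𝓝 0) := by
  let f : ℕ → NonemptyCompacts (EuclideanSpace ℝ (Fin n)) :=
    fun j => ⟨⟨Q j, (hQ j).2.1⟩, (hQ j).2.2⟩
  have hs := isCompact_nonemptyCompacts_subset
    (isCompact_closedBall (0 : EuclideanSpace ℝ (Fin n)) r)
  have hclus : ∀ C : NonemptyCompacts (EuclideanSpace ℝ (Fin n)), MapClusterPt C atTop f →
      (C : Set _) ∈ convexCompacts n ∧ IsHausdorffClusterPt Q C := by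
    intro C hC
    have h : IsHausdorffClusterPt Q (C : Set (EuclideanSpace ℝ (Fin n))) := by
      intro δ hδ
      exact hC.frequently (Metric.eball_mem_nhds C (ENNReal.ofReal_pos.2 hδ))
    exact ⟨⟨h.convex C.isCompact.isClosed fun j => (hQ j).1, C.isCompact, C.nonempty⟩, h⟩
  obtain ⟨L, -, hL⟩ := hs.exists_mapClusterPt_of_frequently (f := f) hr.frequently
  obtain ⟨hLc, hLcl⟩ := hclus L hL
  refine ⟨L, hLc, ?_⟩
  have ht : Tendsto f atTop (𝓝 L) := by
    refine hs.tendsto_nhds_of_unique_mapClusterPt hr fun C _ hC => ?_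
    obtain ⟨hCc, hCcl⟩ := hclus C hC
    exact SetLike.coe_injective
      ((huniq _ hCc _ hLc hCcl hLcl).antisymm (huniq _ hLc _ hCc hLcl hCcl))
  exact tendsto_iff_edist_tendsto_0.1 ht

end HausdorffClusterPt

/-! ### Iterated symmetrizations -/

section Iterate

variable {n : ℕ} {𝒢 : Set (Submodule ℝ (EuclideanSpace ℝ (Fin n)))} {S : SetTransform n}
  {H : ℕ → Submodule ℝ (EuclideanSpace ℝ (Fin n))} {K : Set (EuclideanSpace ℝ (Fin n))}

theorem image_isometryEquiv_mem_convexCompacts (A : EuclideanSpace ℝ (Fin n) ≃ᵢ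
    EuclideanSpace ℝ (Fin n)) (hK : K ∈ convexCompacts n) : A '' K ∈ convexCompacts n := by
  refine ⟨?_, hK.2.1.image A.continuous, hK.2.2.image _⟩
  have h := hK.1.affine_image (A.toRealAffineIsometryEquiv.toAffineEquiv.toAffineMap)
  simpa using h

theorem image_cthickening_isometryEquiv (A : EuclideanSpace ℝ (Fin n) ≃ᵢ
    EuclideanSpace ℝ (Fin n)) (ε : ℝ) (K : Set (EuclideanSpace ℝ (Fin n))) :
    A '' Metric.cthickening ε K = Metric.cthickening ε (A '' K) := by
  ext y
  obtain ⟨x, rfl⟩ := A.surjective y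
  rw [A.injective.mem_set_image, Metric.mem_cthickening_iff, Metric.mem_cthickening_iff,
    Metric.infEDist_image A.isometry]

theorem cthickening_mem_convexCompacts (hK : K ∈ convexCompacts n) (ε : ℝ) :
    Metric.cthickening ε K ∈ convexCompacts n :=
  ⟨hK.1.cthickening ε, hK.2.1.cthickening, hK.2.2.mono (Metric.self_subset_cthickening K)⟩

theorem InFamilyF.symmIterate_mem (hS : InFamilyF 𝒢 S) (hH : ∀ m, H m ∈ 𝒢) (k : ℕ)
    (hK : K ∈ convexCompacts n) (j : ℕ) : symmIterate S H k K j ∈ convexCompacts n := by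
  induction j with
  | zero => exact (hS.isSymmetrization _ (hH _) K hK).1
  | succ j ih => exact (hS.isSymmetrization _ (hH _) _ ih).1

theorem InFamilyF.symmIterate_subset_closedBall (hS : InFamilyF 𝒢 S) (hH : ∀ m, H m ∈ 𝒢) (k : ℕ)
    (hK : K ∈ convexCompacts n) {r : ℝ} (hr : 0 ≤ r) (hKr : K ⊆ Metric.closedBall 0 r) (j : ℕ) :
    symmIterate S H k K j ⊆ Metric.closedBall 0 r := by
  induction j with
  | zero => exact hS.subset_closedBall (hH _) hK hr hKr
  | succ j ih => exact hS.subset_closedBall (hH _) (hS.symmIterate_mem hH k hK j) hr ih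

theorem InFamilyF.symmIterate_zero (hS : InFamilyF 𝒢 S) (hH : ∀ m, H m ∈ 𝒢) (k j : ℕ) :
    symmIterate S H k {0} j = {0} := by
  induction j with
  | zero => exact hS.zero (hH _)
  | succ j ih => rw [symmIterate, ih, hS.zero (hH _)]

theorem InFamilyF.volume_le_symmIterate (hS : InFamilyF 𝒢 S) (hH : ∀ m, H m ∈ 𝒢) (k : ℕ)
    (hK : K ∈ convexCompacts n) (j : ℕ) : volume K ≤ volume (symmIterate S H k K j) := by
  induction j with
  | zero => exact hS.volume_le (hH _) hK
  | succ j ih => exact ih.trans (hS.volume_le (hH _) (hS.symmIterate_mem hH k hK j))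

theorem widthIntegral_symmIterate_minkowskiSymm (H : ℕ → Submodule ℝ (EuclideanSpace ℝ (Fin n)))
    (k : ℕ) (hK : K ∈ convexCompacts n) (j : ℕ) :
    widthIntegral (symmIterate (minkowskiSymm n) H k K j) = widthIntegral K := by
  induction j with
  | zero => exact widthIntegral_half_add_image hK.2.1 hK.2.2 _
  | succ j ih =>
    have h := (inFamilyF_minkowskiSymm univ).symmIterate_mem (H := H) (fun _ => mem_univ _) k hK j
    rw [← ih]
    exact widthIntegral_half_add_image h.2.1 h.2.2 _

/-- Moving `a` and `b` by at most `ε` moves the midpoint of `a` and `R b` by at most `ε`. -/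
theorem minkowskiSymm_cthickening_subset (H : Submodule ℝ (EuclideanSpace ℝ (Fin n)))
    (hK : K ∈ convexCompacts n) {ε : ℝ} (hε : 0 ≤ ε) :
    minkowskiSymm n H (Metric.cthickening ε K) ⊆ Metric.cthickening ε (minkowskiSymm n H K) := by
  intro z hz
  obtain ⟨a, ha, b, hb, rfl⟩ := mem_minkowskiSymm_iff.1 hz
  rw [hK.2.1.cthickening_eq_biUnion_closedBall hε] at ha hb
  simp only [mem_iUnion, Metric.mem_closedBall, exists_prop] at ha hb
  obtain ⟨a', ha', haa⟩ := ha
  obtain ⟨b', hb', hbb⟩ := hb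
  refine Metric.mem_cthickening_of_dist_le _ ((1 / 2 : ℝ) • (a' + H.reflection b')) ε _
    (mem_minkowskiSymm_iff.2 ⟨a', ha', b', hb', rfl⟩) ?_
  rw [dist_smul₀, Real.norm_of_nonneg (by norm_num : (0 : ℝ) ≤ 1 / 2)]
  have h1 := dist_add_add_le a (H.reflection b) a' (H.reflection b')
  rw [LinearIsometryEquiv.dist_map] at h1
  linarith

/-- Iterating `S` from a thickening of a Minkowski iterate stays in the thickening of the later
Minkowski iterates. -/
theorem InFamilyF.symmIterate_cthickening_subset (hS : InFamilyF 𝒢 S) (hH : ∀ m, H m ∈ 𝒢) (k : ℕ)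
    (hK : K ∈ convexCompacts n) {ε : ℝ} (hε : 0 ≤ ε) (j i : ℕ) :
    symmIterate S H (k + (j + 1)) (Metric.cthickening ε (symmIterate (minkowskiSymm n) H k K j)) i ⊆
      Metric.cthickening ε (symmIterate (minkowskiSymm n) H k K (j + 1 + i)) := by
  have hM := (inFamilyF_minkowskiSymm 𝒢).symmIterate_mem hH k hK
  have hT := hS.symmIterate_mem hH (k + (j + 1)) (cthickening_mem_convexCompacts (hM j) ε)
  induction i with
  | zero =>
    -- The iterate with parameter `j` has already used the subspaces `H k, …, H (k + j)`, so the
    -- process resumes with `H (k + (j + 1))`.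
    exact (hS.subset_minkowskiSymm (hH _) (cthickening_mem_convexCompacts (hM j) ε)).trans
      (minkowskiSymm_cthickening_subset _ (hM j) hε)
  | succ i ih =>
    refine (hS.subset_minkowskiSymm (hH _) (hT i)).trans ((minkowskiSymm_mono ih).trans
      ((minkowskiSymm_cthickening_subset _ (hM _) hε).trans (le_of_eq ?_)))
    rw [add_assoc k]
    rfl

/-- Iterates of `S` are contained in the Minkowski iterates of earlier iterates of `S`. -/
theorem InFamilyF.symmIterate_subset_minkowskiSymm (hS : InFamilyF 𝒢 S) (hH : ∀ m, H m ∈ 𝒢) (k : ℕ)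
    (hK : K ∈ convexCompacts n) (j i : ℕ) :
    symmIterate S H k K (j + 1 + i) ⊆
      symmIterate (minkowskiSymm n) H (k + (j + 1)) (symmIterate S H k K j) i := by
  have hT := hS.symmIterate_mem hH k hK
  induction i with
  | zero => exact hS.subset_minkowskiSymm (hH _) (hT j)
  | succ i ih =>
    refine (le_of_eq ?_).trans ((hS.subset_minkowskiSymm (hH _) (hT (j + 1 + i))).trans
      (minkowskiSymm_mono ih))
    rw [add_assoc k]
    rfl

end Iterate

/-! ### Transfer of shape-stability -/

section ShapeStable

open Metric

variable {n : ℕ} {𝒢 : Set (Submodule ℝ (EuclideanSpace ℝ (Fin n)))} {S T : SetTransform n}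
  {H : ℕ → Submodule ℝ (EuclideanSpace ℝ (Fin n))}
  {A : ℕ → EuclideanSpace ℝ (Fin n) ≃ᵢ EuclideanSpace ℝ (Fin n)}
  {K : Set (EuclideanSpace ℝ (Fin n))}

/-- The set `{0}` is fixed by every step, so stability for it makes `A_m 0` converge. This bounds
the translation parts of the isometries. -/
theorem ShapeStableWith.exists_eventually_norm_le (hA : ShapeStableWith S H A)
    (hS : InFamilyF 𝒢 S) (hH : ∀ m, H m ∈ 𝒢) (k : ℕ) :
    ∃ c : ℝ, ∀ᶠ j in atTop, ‖A (k + j) 0‖ ≤ c := by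
  obtain ⟨L, hL, ht⟩ := hA k {0}
    ⟨convex_singleton 0, isCompact_singleton, singleton_nonempty 0⟩
  obtain ⟨c, hc⟩ := (cthickening_mem_convexCompacts hL 1).2.1.isBounded.subset_closedBall
    (0 : EuclideanSpace ℝ (Fin n))
  refine ⟨c, ?_⟩
  filter_upwards [eventually_hausdorffEDist_lt ht one_pos] with j hj
  rw [hS.symmIterate_zero hH, image_singleton] at hj
  exact mem_closedBall_zero_iff.1
    (hc (subset_cthickening_of_hausdorffEDist_lt hj (mem_singleton _)))

theorem ShapeStableWith.exists_eventually_subset_closedBall (hA : ShapeStableWith S H A)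
    (hS : InFamilyF 𝒢 S) (hT : InFamilyF 𝒢 T) (hH : ∀ m, H m ∈ 𝒢) (k : ℕ)
    (hK : K ∈ convexCompacts n) :
    ∃ r : ℝ, ∀ᶠ j in atTop, A (k + j) '' symmIterate T H k K j ⊆ closedBall 0 r := by
  obtain ⟨c, hc⟩ := hA.exists_eventually_norm_le hS hH k
  obtain ⟨r, hr⟩ := hK.2.1.isBounded.subset_closedBall (0 : EuclideanSpace ℝ (Fin n))
  have hr0 : 0 ≤ r := by
    obtain ⟨x, hx⟩ := hK.2.2
    exact (norm_nonneg x).trans (mem_closedBall_zero_iff.1 (hr hx))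
  refine ⟨r + c, ?_⟩
  filter_upwards [hc] with j hj
  rintro _ ⟨x, hx, rfl⟩
  have h1 := hT.symmIterate_subset_closedBall hH k hK hr0 hr j hx
  rw [mem_closedBall] at h1 ⊢
  have h2 := dist_triangle (A (k + j) x) (A (k + j) 0) 0
  rw [(A (k + j)).dist_eq, dist_zero_right (A (k + j) 0)] at h2
  linarith

/-- Upper semicontinuity of volume: some `Y i` lies in each thickening of `L`, and the volumes of
the thickenings tend to that of `L`. -/
theorem le_volume_of_tendsto_hausdorffEDist {Y : ℕ → Set (EuclideanSpace ℝ (Fin n))}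
    {L : Set (EuclideanSpace ℝ (Fin n))} (hL : IsCompact L)
    (ht : Tendsto (fun i => hausdorffEDist (Y i) L) atTop (𝓝 0)) {v : ℝ≥0∞}
    (hv : ∀ i, v ≤ volume (Y i)) : v ≤ volume L := by
  have h := tendsto_measure_cthickening_of_isCompact (μ := volume) hL
  refine ge_of_tendsto (h.mono_left (nhdsWithin_le_nhds (s := Ioi (0 : ℝ)))) ?_
  filter_upwards [self_mem_nhdsWithin] with δ hδ
  obtain ⟨i, hi⟩ := (eventually_hausdorffEDist_lt ht hδ).exists
  exact (hv i).trans (measure_mono (subset_cthickening_of_hausdorffEDist_lt hi))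

/-- The open thickening is an increasing union of closed ones of smaller radius. This recovers the
radius lost when a cluster point is only approximated. -/
theorem volume_thickening_le_of_forall_lt {C : Set (EuclideanSpace ℝ (Fin n))} {ε : ℝ} {v : ℝ≥0∞}
    (h : ∀ ε' < ε, volume (cthickening ε' C) ≤ v) : volume (thickening ε C) ≤ v := by
  have hU : thickening ε C ⊆ ⋃ m : ℕ, cthickening (ε - 1 / ((m : ℝ) + 1)) C := by
    intro x hx
    obtain ⟨y, hy, hxy⟩ := mem_thickening_iff.1 hx
    obtain ⟨m, hm⟩ := exists_nat_one_div_lt (sub_pos.2 hxy)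
    exact mem_iUnion.2 ⟨m, mem_cthickening_of_dist_le x y _ C hy (by linarith)⟩
  refine (measure_mono hU).trans ?_
  have hmono : Monotone fun m : ℕ => cthickening (ε - 1 / ((m : ℝ) + 1)) C := by
    intro i j hij
    refine cthickening_mono ?_ C
    have := one_div_le_one_div_of_le (by positivity : (0 : ℝ) < (i : ℝ) + 1)
      (by gcongr : (i : ℝ) + 1 ≤ (j : ℝ) + 1)
    linarith
  rw [hmono.measure_iUnion]
  exact iSup_le fun m => h _ (by have : (0 : ℝ) < 1 / ((m : ℝ) + 1) := by positivity
                                 linarith)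

/-- With a null frontier, the open and closed thickenings have equal finite volume, so the part of
the closed one outside `D` is null. Its open counterpart is an open null set, hence empty. -/
theorem thickening_subset_of_volume_le {C D : Set (EuclideanSpace ℝ (Fin n))} (hC : IsCompact C)
    (hD : IsClosed D) {ε : ℝ} (hε : 0 < ε) (hfr : volume (frontier (thickening ε C)) = 0)
    (h : volume (thickening ε C) ≤ volume (cthickening ε C ∩ D)) : thickening ε C ⊆ D := by
  have hfin : volume (cthickening ε C) ≠ ⊤ := hC.cthickening.measure_lt_top.ne
  have heq : volume (cthickening ε C) ≤ volume (thickening ε C) := by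
    have h1 : cthickening ε C ⊆ thickening ε C ∪ frontier (thickening ε C) := by
      rw [← closure_thickening hε, closure_eq_self_union_frontier]
    refine (measure_mono h1).trans ((measure_union_le _ _).trans ?_)
    rw [hfr, add_zero]
  have hdiff : volume (cthickening ε C \ D) = 0 := by
    have h2 := measure_inter_add_sdiff (μ := volume) (cthickening ε C) hD.measurableSet
    have h3 : volume (cthickening ε C ∩ D) + volume (cthickening ε C \ D) ≤
        volume (cthickening ε C ∩ D) + 0 := by
      rw [h2, add_zero]
      exact heq.trans h
    have h4 : volume (cthickening ε C ∩ D) ≠ ⊤ :=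
      ne_top_of_le_ne_top hfin (measure_mono inter_subset_left)
    exact le_antisymm ((ENNReal.add_le_add_iff_left h4).1 h3) zero_le
  have hopen : IsOpen (thickening ε C \ D) := isOpen_thickening.sdiff hD
  have hnull : volume (thickening ε C \ D) = 0 :=
    measure_mono_null (sdiff_subset_sdiff_left (thickening_subset_cthickening ε C)) hdiff
  exact sdiff_eq_empty.1 (hopen.measure_eq_zero_iff volume |>.1 hnull)

/-- Shape-stability for a member of `ℱ` implies shape-stability for Minkowski symmetrization. -/
theorem ShapeStableWith.minkowskiSymm (hA : ShapeStableWith S H A) (hS : InFamilyF 𝒢 S)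
    (hH : ∀ m, H m ∈ 𝒢) : ShapeStableWith (minkowskiSymm n) H A := by
  intro k K hK
  have hM := inFamilyF_minkowskiSymm 𝒢
  have hMK := hM.symmIterate_mem hH k hK
  obtain ⟨r, hr⟩ := hA.exists_eventually_subset_closedBall hS hM hH k hK
  refine exists_tendsto_of_forall_clusterPt_subset
    (fun j => image_isometryEquiv_mem_convexCompacts _ (hMK j)) hr ?_
  intro C hC C' hC' hclC hclC'
  rw [← hC'.2.1.isClosed.closure_eq, closure_eq_iInter_cthickening]
  refine subset_iInter₂ fun δ hδ => ?_
  -- Radii with null frontier exist below every `δ`.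
  obtain ⟨ε, ⟨hε, hεδ⟩, hfr⟩ := exists_null_frontier_thickening
    (volume : Measure (EuclideanSpace ℝ (Fin n))) C hδ
  refine Subset.trans ?_ (cthickening_mono hεδ.le C')
  refine (self_subset_thickening hε C).trans
    (thickening_subset_of_volume_le hC.2.1 isClosed_cthickening hε hfr
      (volume_thickening_le_of_forall_lt fun ε' hε' => ?_))
  -- Close enough to `C` that the `ε`-thickening of this iterate contains the `ε'`-thickening of
  -- `C`; the maximum covers negative `ε'`.
  obtain ⟨j, hj⟩ := (hclC (ε - max ε' 0) (sub_pos.2 (max_lt hε' hε))).exists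
  have hX := cthickening_mem_convexCompacts (hMK j) ε
  obtain ⟨L, hL, hLt⟩ := hA (k + (j + 1)) _ hX
  have hLsub : ∀ D : Set (EuclideanSpace ℝ (Fin n)),
      IsHausdorffClusterPt (fun j => A (k + j) '' symmIterate (_root_.minkowskiSymm n) H k K j) D →
      L ⊆ cthickening ε D := by
    intro D hD
    refine (hD.comp_add_left (j + 1)).limit_subset_cthickening hLt hε.le fun i => ?_
    rw [← image_cthickening_isometryEquiv, add_assoc k]
    exact image_mono (hS.symmIterate_cthickening_subset hH k hK hε.le j i)
  calc volume (cthickening ε' C)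
      ≤ volume (cthickening (max ε' 0) C) :=
        measure_mono (cthickening_mono (le_max_left _ _) C)
    _ ≤ volume (A (k + j) '' cthickening ε (symmIterate (_root_.minkowskiSymm n) H k K j)) := by
        refine measure_mono ?_
        rw [image_cthickening_isometryEquiv]
        refine (cthickening_subset_of_subset _
          (subset_cthickening_of_hausdorffEDist_lt' hj)).trans
          ((cthickening_cthickening_subset (le_max_right _ _)
            (sub_pos.2 (max_lt hε' hε)).le _).trans (le_of_eq ?_))
        congr 1
        ring
    _ = volume (cthickening ε (symmIterate (_root_.minkowskiSymm n) H k K j)) :=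
        volume_image_isometryEquiv _ _
    _ ≤ volume L := by
        refine le_volume_of_tendsto_hausdorffEDist hL.2.1 hLt fun i => ?_
        rw [volume_image_isometryEquiv]
        exact hS.volume_le_symmIterate hH _ hX i
    _ ≤ volume (cthickening ε C ∩ cthickening ε C') :=
        measure_mono (subset_inter (hLsub C hclC) (hLsub C' hclC'))

/-- Shape-stability for Minkowski symmetrization implies shape-stability for each member of
`ℱ`. -/
theorem ShapeStableWith.of_minkowskiSymm (hA : ShapeStableWith (_root_.minkowskiSymm n) H A)
    (hT : InFamilyF 𝒢 T) (hH : ∀ m, H m ∈ 𝒢) : ShapeStableWith T H A := by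
  intro k K hK
  have hM := inFamilyF_minkowskiSymm 𝒢
  have hTK := hT.symmIterate_mem hH k hK
  obtain ⟨r, hr⟩ := hA.exists_eventually_subset_closedBall hM hT hH k hK
  have hQ := fun j => image_isometryEquiv_mem_convexCompacts (A (k + j)) (hTK j)
  refine exists_tendsto_of_forall_clusterPt_subset hQ hr ?_
  intro C hC C' hC' hclC hclC'
  refine subset_of_forall_exists_widthIntegral_le hC'.1 hC'.2.1 hC'.2.2 hC.2.1 hC.2.2
    fun δ hδ => ?_
  set b := (volume (ball (0 : EuclideanSpace ℝ (Fin n)) 1)).toReal with hb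
  have hb0 : 0 ≤ b := ENNReal.toReal_nonneg
  -- Width is compared twice, between `L` and a Minkowski iterate and between the `T`-iterate and
  -- `C'`, each at a cost of `η * b`. The `+ 1` keeps the denominator positive.
  set η : ℝ := δ / (2 * (b + 1)) with hη
  have hη0 : 0 < η := by positivity
  have hηb : 2 * (η * b) ≤ δ := by
    have : 2 * (η * (b + 1)) = δ := by rw [hη]; field_simp
    nlinarith
  obtain ⟨j, hj⟩ := (hclC' η hη0).exists
  obtain ⟨L, hL, hLt⟩ := hA (k + (j + 1)) _ (hTK j)
  have hLsub : ∀ D : Set (EuclideanSpace ℝ (Fin n)),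
      IsHausdorffClusterPt (fun j => A (k + j) '' symmIterate T H k K j) D → D ⊆ L := by
    intro D hD
    refine (hD.comp_add_left (j + 1)).subset_limit hLt hL.2.1.isClosed fun i => ?_
    rw [add_assoc k]
    -- The Minkowski process restarted from the `T`-iterate dominates all later `T`-iterates, so `L`
    -- contains every cluster point.
    exact image_mono (hT.symmIterate_subset_minkowskiSymm hH k hK j i)
  refine ⟨L, hL.2.1, hLsub C' hclC', hLsub C hclC, ?_⟩
  obtain ⟨i, hi⟩ := (eventually_hausdorffEDist_lt hLt hη0).exists
  have hMi := hM.symmIterate_mem hH (k + (j + 1)) (hTK j) i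
  have h1 := widthIntegral_le_add_of_subset_cthickening hL.2.1 hL.2.2
    (image_isometryEquiv_mem_convexCompacts (A (k + (j + 1) + i)) hMi).2.1 hη0.le
    (subset_cthickening_of_hausdorffEDist_lt' hi)
  rw [widthIntegral_image_isometryEquiv _ hMi.2.1 hMi.2.2,
    widthIntegral_symmIterate_minkowskiSymm H _ (hTK j)] at h1
  have h2 := widthIntegral_le_add_of_subset_cthickening (hQ j).2.1 (hQ j).2.2 hC'.2.1 hη0.le
    (subset_cthickening_of_hausdorffEDist_lt hj)
  rw [widthIntegral_image_isometryEquiv _ (hTK j).2.1 (hTK j).2.2] at h2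
  rw [← hb] at h1 h2
  linarith

theorem shapeStableWith_iff (hS : InFamilyF 𝒢 S) (hT : InFamilyF 𝒢 T) (hH : ∀ m, H m ∈ 𝒢) :
    ShapeStableWith S H A ↔ ShapeStableWith T H A :=
  ⟨fun h => (h.minkowskiSymm hS hH).of_minkowskiSymm hT hH,
    fun h => (h.minkowskiSymm hT hH).of_minkowskiSymm hS hH⟩

/-- The two symmetrizations agree only on convex compact sets, so the induction needs the iterates
to stay in that class. Membership of Steiner symmetrization in `ℱ` is bypassed, as `𝒢` may contain
subspaces that are not hyperplanes. -/
theorem symmIterate_steinerSymm (hH : ∀ m, IsHyperplane (H m)) (k : ℕ)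
    (hK : K ∈ convexCompacts n) (j : ℕ) :
    symmIterate (steinerSymm n) H k K j = symmIterate (fiberSymm n) H k K j := by
  induction j with
  | zero => exact steinerSymm_eq_fiberSymm (hH _) hK
  | succ j ih =>
    rw [symmIterate, symmIterate, ih]
    exact steinerSymm_eq_fiberSymm (hH _)
      ((inFamilyF_fiberSymm univ).symmIterate_mem (fun _ => mem_univ _) k hK j)

theorem shapeStableWith_steinerSymm_iff (hH : ∀ m, IsHyperplane (H m)) :
    ShapeStableWith (steinerSymm n) H A ↔ ShapeStableWith (fiberSymm n) H A :=
  forall_congr' fun k => forall₂_congr fun K hK => by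
    simp only [symmIterate_steinerSymm hH k hK]

end ShapeStable

theorem theorem3 (n : ℕ) (𝒢 : Set (Submodule ℝ (EuclideanSpace ℝ (Fin n))))
    (S : SetTransform n) (hS : InFamilyF 𝒢 S)
    (H : ℕ → Submodule ℝ (EuclideanSpace ℝ (Fin n))) (hH : ∀ m, H m ∈ 𝒢)
    (A : ℕ → EuclideanSpace ℝ (Fin n) ≃ᵢ EuclideanSpace ℝ (Fin n)) :
    (ShapeStableWith S H A → ∀ T : SetTransform n, InFamilyF 𝒢 T → ShapeStableWith T H A) ∧
    (ShapeStableWith S H A ↔ ShapeStableWith (fiberSymm n) H A) ∧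
    (ShapeStableWith S H A ↔ ShapeStableWith (minkowskiSymm n) H A) ∧
    ((∀ m, IsHyperplane (H m)) →
      (ShapeStableWith S H A ↔ ShapeStableWith (steinerSymm n) H A)) := by
  refine ⟨fun h T hT => (shapeStableWith_iff hS hT hH).1 h,
    shapeStableWith_iff hS (inFamilyF_fiberSymm 𝒢) hH,
    shapeStableWith_iff hS (inFamilyF_minkowskiSymm 𝒢) hH, fun hhyp => ?_⟩
  rw [shapeStableWith_steinerSymm_iff hhyp]
  exact shapeStableWith_iff hS (inFamilyF_fiberSymm 𝒢) hH
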